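/- Write $\mathbb{D}=\{z\in\mathbb{C}:|z|<1\}$. For a holomorphic $f\colon\mathbb{D}\to\mathbb{D}$ and $\sigma\in\partial\mathbb{D}$, the boundary dilation coefficient of $f$ at $\sigma$ is \[ \beta_f(\sigma)=\inf_{\tau\in\partial\mathbb{D}}\ \sup_{z\in\mathbb{D}}\ \left\{\frac{|\tau-f(z)|^2}{1-|f(z)|^2}\bigg/\frac{|\sigma-z|^2}{1-|z|^2}\right\}\in[0,+\infty], \] and $f(\sigma)$ denotes the non-tangential limit of $f$ at $\sigma$ when it exists, that is, the common limit of $f(z)$ as $z\to\sigma$ within each region $\{z\in\mathbb{D}:|\sigma-z|<M(1-|z|)\}$, $M>1$. A Blaschke product of degree $d\ge 0$ is a holomorphic function on $\mathbb{D}$ that extends continuously to $\overline{\mathbb{D}}$ with values of modulus $1$ on $\partial\mathbb{D}$ and that has exactly $d$ zeros in $\mathbb{D}$, counted with multiplicity. Let $k\ge 1$ and let $f\colon\mathbb{D}\to\mathbb{D}$ be holomorphic, not a Blaschke product of degree at most $k$, with \[ f(0)=f'(0)=\cdots=f^{(k-1)}(0)=0 . \] Let $n\ge 0$ and let $\sigma_1,\ldots,\sigma_n\in\partial\mathbb{D}$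 be distinct points such that, for $j=1,\ldots,n$, $\beta_f(\sigma_j)<+\infty$ and $f$ has non-tangential limit $f(\sigma_j)=\sigma_j^k$ at $\sigma_j$. Then $\beta_f(\sigma_j)>k$ for every $j$, $\frac{f^{(k)}(0)}{k!}\neq 1$, and \[ \sum_{j=1}^{n}\frac{1}{\beta_f(\sigma_j)-k}\le\frac{1-\left|\frac{f^{(k)}(0)}{k!}\right|^2}{\left|1-\frac{f^{(k)}(0)}{k!}\right|^2}, \] with equality if and only if $f$ is a Blaschke product of degree $n+k$. -/

import Mathlib

open Filter Topology Metric

/-- `f` is a holomorphic self-map of the open unit disk (only the values of `f` on the disk matter). -/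
def IsDiskSelfMap (f : ℂ → ℂ) : Prop :=
  DifferentiableOn ℂ f (ball 0 1) ∧ Set.MapsTo f (ball 0 1) (ball 0 1)

/-- `f` is a finite Blaschke product of degree `d`: it is holomorphic in the unit disk, extends
continuously to the closed disk with unimodular values on the unit circle, and has exactly `d` zeros
in the disk counted with multiplicity; `s` is the multiset of these zeros.
By the maximum principle `f` is then a self-map of the open disk when `1 ≤ d`,
and a constant of modulus one when `d = 0`. -/
def IsBlaschkeProduct (d : ℕ) (f : ℂ → ℂ) : Prop :=
  DifferentiableOn ℂ f (ball 0 1) ∧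
  (∃ F : ℂ → ℂ, ContinuousOn F (closedBall 0 1) ∧ Set.EqOn F f (ball 0 1) ∧
    Set.MapsTo F (sphere 0 1) (sphere 0 1)) ∧
  ∃ s : Multiset ℂ, s.card = d ∧ (∀ a ∈ s, a ∈ ball (0 : ℂ) 1) ∧
    ∀ z ∈ ball (0 : ℂ) 1, analyticOrderAt f z = (s.count z : ℕ∞)

/-- `β_f(σ, τ)`: the supremum over the disk of
`(|τ - f z|² / (1 - |f z|²)) / (|σ - z|² / (1 - |z|²))`, in `[0, ∞]`. -/
noncomputable def boundaryDilationAt (f : ℂ → ℂ) (σ τ : ℂ) : ENNReal :=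
  ⨆ z ∈ ball (0 : ℂ) 1,
    ENNReal.ofReal ((‖τ - f z‖ ^ 2 / (1 - ‖f z‖ ^ 2)) / (‖σ - z‖ ^ 2 / (1 - ‖z‖ ^ 2)))

/-- The boundary dilation coefficient `β_f(σ)`, the infimum of `β_f(σ, τ)` over `τ` in the unit
circle, in `[0, ∞]`. -/
noncomputable def boundaryDilation (f : ℂ → ℂ) (σ : ℂ) : ENNReal :=
  ⨅ τ ∈ sphere (0 : ℂ) 1, boundaryDilationAt f σ τ

/-- The Stolz region of vertex `σ` and amplitude `M`. -/
def stolzRegion (σ : ℂ) (M : ℝ) : Set ℂ :=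
  {z | z ∈ ball (0 : ℂ) 1 ∧ ‖σ - z‖ / (1 - ‖z‖) < M}

/-- `f` has non-tangential limit `c` at the point `σ` of the unit circle. -/
def HasNonTangentialLimit (f : ℂ → ℂ) (σ c : ℂ) : Prop :=
  ∀ M : ℝ, 1 < M → Tendsto f (𝓝[stolzRegion σ M] σ) (𝓝 c)

/-! Write `f = z ^ k * g`. By the Schwarz lemma `g` is bounded by one, and it maps into the open
disk because `f` is not a unimodular multiple of `z ^ k`; its value `a` at 0 is the `k`-th Taylor
coefficient of `f`. The Cayley transform `H = (1 + g) / (1 - g)` has positive real part, so it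
behaves like the Herglotz transform of a positive measure on the circle, of total mass `Re H(0) = (1
- ‖a‖ ^ 2) / ‖1 - a‖ ^ 2`. The dilation coefficient is the size of the angular derivative
(`tendsto_radial_sub_div`), and dividing by `z ^ k` lowers it by `k`, so the mass at `σ j` is `1 /
(β - k)` (`tendsto_cayley_quotient`). The inequality says that point masses do not exceed the total
mass.

No measure is constructed. A mass is the radial limit of `(1 - r) / (1 + r) * H (r σ)`, and Julia's
lemma lets the kernels `c * (σ + z) / (σ - z)` be subtracted one at a time without losing
nonnegativity of the real part (`re_sub_sum_herglotz_nonneg`).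

In case of equality the remainder has zero real part at 0, hence is constant; then `g` is rational
with unimodular boundary values (`isBlaschkeProduct_of_cayley_eq`). Conversely, for a Blaschke
product `H` is rational with poles only at the `σ j`, and the remainder is an imaginary constant
(`re_cayley_zero_eq_sum`). -/

/-! ### Schwarz–Pick and Harnack inequalities for the right half-plane -/

open ComplexConjugate in
lemma one_sub_conj_mul_normSq (z w : ℂ) :
    ‖1 - conj w * z‖ ^ 2 = ‖z - w‖ ^ 2 + (1 - ‖z‖ ^ 2) * (1 - ‖w‖ ^ 2) := by
  simp only [Complex.sq_norm, Complex.normSq_apply]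
  simp
  ring

/-- For unimodular `τ` this is the Poisson kernel; it serves both the Cayley transforms (`w = f z`)
and the Herglotz kernels (`w = z`). -/
lemma re_add_div_sub (τ w : ℂ) :
    ((τ + w) / (τ - w)).re = (‖τ‖ ^ 2 - ‖w‖ ^ 2) / ‖τ - w‖ ^ 2 := by
  simp only [Complex.div_re, Complex.sq_norm, Complex.normSq_apply, ← add_div]
  congr 1
  simp
  ring

open ComplexConjugate in
lemma norm_sub_sq_eq_re (x y : ℂ) : ‖x - y‖ ^ 2 = ‖x + conj y‖ ^ 2 - 4 * x.re * y.re := by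
  simp only [Complex.sq_norm, Complex.normSq_apply]
  simp
  ring

-- Schwarz lemma for `(H - H 0) / (H + conj (H 0))`, with the denominator cleared by
-- `norm_sub_sq_eq_re`.
open ComplexConjugate in
lemma schwarz_halfPlane_zero {H : ℂ → ℂ} (hd : DifferentiableOn ℂ H (ball 0 1))
    (hre : ∀ z ∈ ball (0 : ℂ) 1, 0 < (H z).re) {z : ℂ} (hz : z ∈ ball (0 : ℂ) 1) :
    ‖H z - H 0‖ ^ 2 * (1 - ‖z‖ ^ 2) ≤ 4 * ‖z‖ ^ 2 * (H z).re * (H 0).re := by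
  have h0 := hre 0 (by simp)
  have hne : ∀ u ∈ ball (0 : ℂ) 1, H u + conj (H 0) ≠ 0 := by
    intro u hu h
    have := congrArg Complex.re h
    have := hre u hu
    simp at *
    linarith
  have hlt : ∀ u ∈ ball (0 : ℂ) 1, ‖(H u - H 0) / (H u + conj (H 0))‖ ≤ 1 := by
    intro u hu
    rw [norm_div]
    refine div_le_one_of_le₀ ?_ (norm_nonneg _)
    rw [← sq_le_sq₀ (norm_nonneg _) (norm_nonneg _)]
    rw [norm_sub_sq_eq_re]
    nlinarith [mul_pos (hre u hu) h0]
  have key := Complex.norm_le_norm_of_mapsTo_ball (R := 1) (z := z)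
    (f := fun u ↦ (H u - H 0) / (H u + conj (H 0)))
    ((hd.sub_const _).div (hd.add_const _) hne)
    (fun u hu ↦ by simpa using hlt u hu) (by simp) (by simpa using hz)
  simp only [norm_div] at key
  rw [div_le_iff₀ (norm_pos_iff.2 (hne z hz))] at key
  have h2 : ‖H z - H 0‖ ^ 2 ≤ ‖z‖ ^ 2 * ‖H z + conj (H 0)‖ ^ 2 := by
    rw [← mul_pow]
    gcongr
  have h3 := norm_sub_sq_eq_re (H z) (H 0)
  nlinarith

-- Precomposing with the disk automorphism `u ↦ (u + w) / (1 + conj w * u)` moves the base point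
-- from 0 to `w`.
open ComplexConjugate in
lemma schwarz_pick_halfPlane_of_pos {H : ℂ → ℂ} (hd : DifferentiableOn ℂ H (ball 0 1))
    (hre : ∀ z ∈ ball (0 : ℂ) 1, 0 < (H z).re) {z w : ℂ} (hz : z ∈ ball (0 : ℂ) 1)
    (hw : w ∈ ball (0 : ℂ) 1) :
    ‖H z - H w‖ ^ 2 * ((1 - ‖z‖ ^ 2) * (1 - ‖w‖ ^ 2)) ≤
      4 * ‖z - w‖ ^ 2 * (H z).re * (H w).re := by
  have hne : ∀ a ∈ ball (0 : ℂ) 1, ∀ u ∈ ball (0 : ℂ) 1, 1 + conj a * u ≠ 0 := by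
    intro a ha u hu h
    simp only [mem_ball_zero_iff] at ha hu
    have h1 : conj a * u = -1 := by linear_combination h
    have h2 := congrArg norm h1
    simp only [norm_mul, RCLike.norm_conj, norm_neg, norm_one] at h2
    nlinarith [norm_nonneg a, norm_nonneg u]
  have hlt : ∀ a ∈ ball (0 : ℂ) 1, ∀ u ∈ ball (0 : ℂ) 1,
      (u + a) / (1 + conj a * u) ∈ ball (0 : ℂ) 1 := by
    intro a ha u hu
    have hn := norm_pos_iff.2 (hne a ha u hu)
    rw [mem_ball_zero_iff, norm_div, div_lt_one hn]
    refine lt_of_pow_lt_pow_left₀ 2 (norm_nonneg _) ?_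
    have := one_sub_conj_mul_normSq u (-a)
    simp only [map_neg, neg_mul, sub_neg_eq_add, norm_neg] at this
    rw [this]
    simp only [mem_ball_zero_iff] at ha hu
    have : 0 < (1 - ‖u‖ ^ 2) * (1 - ‖a‖ ^ 2) := by
      apply mul_pos <;> nlinarith [norm_nonneg a, norm_nonneg u]
    linarith
  have hw' : -w ∈ ball (0 : ℂ) 1 := by simpa using hw
  have hu := hlt (-w) hw' z hz
  have hnz := hne (-w) hw' z hz
  set u : ℂ := (z + -w) / (1 + conj (-w) * z) with hu_def
  have key := schwarz_halfPlane_zero (H := fun u ↦ H ((u + w) / (1 + conj w * u)))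
    (hd.comp (g := H) (DifferentiableOn.div (by fun_prop) (by fun_prop) (hne w hw)) (hlt w hw))
    (fun u hu ↦ hre _ (hlt w hw u hu)) hu
  have hback : (u + w) / (1 + conj w * u) = z := by
    have hnz' : 1 - conj w * z ≠ 0 := by simpa [sub_eq_add_neg] using hnz
    have hu' : u = (z - w) / (1 - conj w * z) := by
      rw [hu_def]; simp [sub_eq_add_neg]
    rw [div_eq_iff (hne w hw u hu)]
    rw [eq_div_iff hnz'] at hu'
    linear_combination hu'
  simp only [hback, zero_add, mul_zero, add_zero, div_one] at key
  have hd' : 0 < ‖1 + conj (-w) * z‖ ^ 2 := by positivity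
  have hnu : ‖u‖ ^ 2 * ‖1 + conj (-w) * z‖ ^ 2 = ‖z - w‖ ^ 2 := by
    rw [hu_def, norm_div, ← mul_pow, div_mul_cancel₀ _ (norm_ne_zero_iff.2 hnz), sub_eq_add_neg]
  have hid := one_sub_conj_mul_normSq z w
  rw [show 1 - conj w * z = 1 + conj (-w) * z by simp; ring] at hid
  have := mul_le_mul_of_nonneg_right key hd'.le
  calc _ = ‖H z - H w‖ ^ 2 * (1 - ‖u‖ ^ 2) * ‖1 + conj (-w) * z‖ ^ 2 := by
        rw [mul_assoc, sub_mul (1 : ℝ) (‖u‖ ^ 2), hnu, hid]; ring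
    _ ≤ _ := this
    _ = _ := by rw [← hnu]; ring

/-- Apply the strict case to `H + ε` and let `ε → 0`. The real part must be allowed to vanish, since
it can do so once masses are subtracted. -/
lemma schwarz_pick_halfPlane {H : ℂ → ℂ} (hd : DifferentiableOn ℂ H (ball 0 1))
    (hre : ∀ z ∈ ball (0 : ℂ) 1, 0 ≤ (H z).re) {z w : ℂ} (hz : z ∈ ball (0 : ℂ) 1)
    (hw : w ∈ ball (0 : ℂ) 1) :
    ‖H z - H w‖ ^ 2 * ((1 - ‖z‖ ^ 2) * (1 - ‖w‖ ^ 2)) ≤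
      4 * ‖z - w‖ ^ 2 * (H z).re * (H w).re := by
  have hlim : Tendsto (fun ε : ℝ ↦ 4 * ‖z - w‖ ^ 2 * ((H z).re + ε) * ((H w).re + ε)) (𝓝[>] 0)
      (𝓝 (4 * ‖z - w‖ ^ 2 * ((H z).re + 0) * ((H w).re + 0))) := by
    refine Tendsto.mono_left (Continuous.tendsto ?_ 0) nhdsWithin_le_nhds
    fun_prop
  simp only [add_zero] at hlim
  refine ge_of_tendsto hlim ?_
  filter_upwards [self_mem_nhdsWithin] with ε hε
  have hε : 0 < ε := hε
  have := schwarz_pick_halfPlane_of_pos (H := fun z ↦ H z + ε) (hd.add_const _)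
    (fun u hu ↦ by have := hre u hu; simp; linarith) hz hw
  simpa using this

/-- The factor 4 on `‖z - w‖ ^ 2` has to be sharp: it cancels the limit of `(1 + r) ^ 2` in Julia's
lemma. The other term may be crude, as it vanishes when `w` tends to the circle. -/
lemma harnack_halfPlane {H : ℂ → ℂ} (hd : DifferentiableOn ℂ H (ball 0 1))
    (hre : ∀ z ∈ ball (0 : ℂ) 1, 0 ≤ (H z).re) {z w : ℂ} (hz : z ∈ ball (0 : ℂ) 1)
    (hw : w ∈ ball (0 : ℂ) 1) :
    (H w).re * ((1 - ‖z‖ ^ 2) * (1 - ‖w‖ ^ 2)) ≤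
      4 * (‖z - w‖ ^ 2 + (1 - ‖z‖ ^ 2) * (1 - ‖w‖ ^ 2)) * (H z).re := by
  have h1 := schwarz_pick_halfPlane hd hre hz hw
  have hx := hre z hz
  have hy := hre w hw
  have hA : 0 < (1 - ‖z‖ ^ 2) * (1 - ‖w‖ ^ 2) := by
    simp only [mem_ball_zero_iff] at hz hw
    apply mul_pos <;> nlinarith [norm_nonneg z, norm_nonneg w]
  set A := (1 - ‖z‖ ^ 2) * (1 - ‖w‖ ^ 2)
  have h2 : ((H z).re - (H w).re) ^ 2 ≤ ‖H z - H w‖ ^ 2 := by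
    rw [← Complex.sub_re, ← sq_abs]
    gcongr
    exact Complex.abs_re_le_norm _
  have h3 := mul_le_mul_of_nonneg_right h2 hA.le
  rcases hy.eq_or_lt with h | h
  · rw [← h]; simp; positivity
  · refine le_of_mul_le_mul_left ?_ h
    nlinarith [mul_nonneg (mul_nonneg hx hy) hA.le, mul_nonneg (sq_nonneg (H z).re) hA.le]

/-! ### The Julia–Carathéodory theorem -/

lemma ofReal_mul_mem_ball {σ : ℂ} (hσ : σ ∈ sphere (0 : ℂ) 1) {r : ℝ} (h0 : 0 < r) (h1 : r < 1) :
    (r : ℂ) * σ ∈ ball (0 : ℂ) 1 := by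
  simp only [mem_sphere_zero_iff_norm] at hσ
  simp [hσ, abs_of_pos h0, h1]

lemma eventually_mem_Ioo_zero_one : ∀ᶠ r : ℝ in 𝓝[<] 1, 0 < r ∧ r < 1 := by
  filter_upwards [Ioo_mem_nhdsLT (zero_lt_one' ℝ)] with r hr using hr

lemma norm_sub_pos_of_mem {σ z : ℂ} (hσ : σ ∈ sphere (0 : ℂ) 1) (hz : z ∈ ball (0 : ℂ) 1) :
    0 < ‖σ - z‖ := by
  rw [norm_pos_iff, sub_ne_zero]
  rintro rfl
  simp only [mem_ball_zero_iff, mem_sphere_zero_iff_norm] at *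
  linarith

lemma one_sub_sq_pos_of_mem {z : ℂ} (hz : z ∈ ball (0 : ℂ) 1) : 0 < 1 - ‖z‖ ^ 2 := by
  simp only [mem_ball_zero_iff] at *
  nlinarith [norm_nonneg z]

/-- The Julia lemma and the existence of the radial limit, for the real part. -/
lemma julia_halfPlane_re {H : ℂ → ℂ} (hd : DifferentiableOn ℂ H (ball 0 1))
    (hre : ∀ z ∈ ball (0 : ℂ) 1, 0 ≤ (H z).re) {σ : ℂ} (hσ : σ ∈ sphere (0 : ℂ) 1) :
    ∃ c : ℝ, 0 ≤ c ∧ (∀ z ∈ ball (0 : ℂ) 1, c * ((1 - ‖z‖ ^ 2) / ‖σ - z‖ ^ 2) ≤ (H z).re) ∧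
      Tendsto (fun r : ℝ ↦ (1 - r) / (1 + r) * (H (r * σ)).re) (𝓝[<] 1) (𝓝 c) := by
  have hσ1 : ‖σ‖ = 1 := by simpa using hσ
  -- The mass at `σ` is the infimum of the ratio of `Re H` to the Poisson kernel at `σ`.
  set q : ball (0 : ℂ) 1 → ℝ := fun z ↦ (H z).re / ((1 - ‖(z : ℂ)‖ ^ 2) / ‖σ - z‖ ^ 2)
  have hP : ∀ z ∈ ball (0 : ℂ) 1, 0 < (1 - ‖z‖ ^ 2) / ‖σ - z‖ ^ 2 := fun z hz ↦
    div_pos (one_sub_sq_pos_of_mem hz) (pow_pos (norm_sub_pos_of_mem hσ hz) 2)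
  have hq0 : ∀ z, 0 ≤ q z := fun z ↦ div_nonneg (hre z z.2) (hP z z.2).le
  have hbdd : BddBelow (Set.range q) := ⟨0, by rintro _ ⟨z, rfl⟩; exact hq0 z⟩
  have : Nonempty (ball (0 : ℂ) 1) := ⟨⟨0, by simp⟩⟩
  have hle : ∀ z ∈ ball (0 : ℂ) 1, (⨅ z, q z) * ((1 - ‖z‖ ^ 2) / ‖σ - z‖ ^ 2) ≤ (H z).re :=
    fun z hz ↦ (le_div_iff₀ (hP z hz)).1 (ciInf_le hbdd ⟨z, hz⟩)
  refine ⟨⨅ z, q z, le_ciInf hq0, hle, ?_⟩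
  refine tendsto_order.2 ⟨fun a ha ↦ ?_, fun a ha ↦ ?_⟩
  · filter_upwards [eventually_mem_Ioo_zero_one] with r hr
    refine ha.trans_le ?_
    have h1 := hle _ (ofReal_mul_mem_ball hσ hr.1 hr.2)
    have h2 : ‖σ - r * σ‖ = 1 - r := by
      rw [show σ - r * σ = ((1 - r : ℝ) : ℂ) * σ by push_cast; ring, norm_mul, hσ1,
        Complex.norm_real, Real.norm_of_nonneg (by linarith), mul_one]
    have h3 : ‖(r : ℂ) * σ‖ = r := by
      rw [norm_mul, hσ1, Complex.norm_real, Real.norm_of_nonneg hr.1.le, mul_one]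
    rw [h2, h3] at h1
    have h4 : (1 - r ^ 2) / (1 - r) ^ 2 = (1 + r) / (1 - r) := by
      have : 1 - r ≠ 0 := by linarith
      field_simp
      ring
    rw [h4] at h1
    have h5 : 0 < 1 - r := by linarith
    have h6 : 0 < 1 + r := by linarith
    rw [div_mul_eq_mul_div, le_div_iff₀ h6]
    rw [← mul_div_assoc, div_le_iff₀ h5] at h1
    linarith
  -- Harnack between a near-minimizer `z` and `r σ`: the resulting bound tends to `q z` as `r → 1`.
  · obtain ⟨⟨z, hz⟩, hza⟩ := exists_lt_of_ciInf_lt ha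
    have hlim : Tendsto (fun r : ℝ ↦ 4 * (‖z - r * σ‖ ^ 2 + (1 - ‖z‖ ^ 2) * (1 - r ^ 2)) *
        (H z).re / ((1 - ‖z‖ ^ 2) * (1 + r) ^ 2)) (𝓝[<] 1) (𝓝 (q ⟨z, hz⟩)) := by
      have hz1 := one_sub_sq_pos_of_mem hz
      have hc : ContinuousAt (fun r : ℝ ↦ 4 * (‖z - r * σ‖ ^ 2 + (1 - ‖z‖ ^ 2) * (1 - r ^ 2)) *
        (H z).re / ((1 - ‖z‖ ^ 2) * (1 + r) ^ 2)) 1 := by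
        refine ContinuousAt.div (by fun_prop) (by fun_prop) ?_
        positivity
      have := hc.tendsto.mono_left (nhdsWithin_le_nhds (s := Set.Iio 1))
      convert this using 2
      simp only [q]
      have := norm_sub_pos_of_mem hσ hz
      rw [norm_sub_rev σ z] at this ⊢
      simp
      field_simp
      ring
    filter_upwards [eventually_mem_Ioo_zero_one, hlim.eventually_lt_const hza] with r hr hra
    refine lt_of_le_of_lt ?_ hra
    have h1 := harnack_halfPlane hd hre hz (ofReal_mul_mem_ball hσ hr.1 hr.2)
    have h3 : ‖(r : ℂ) * σ‖ = r := by
      rw [norm_mul, hσ1, Complex.norm_real, Real.norm_of_nonneg hr.1.le, mul_one]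
    rw [h3] at h1
    have h6 : 0 < 1 + r := by linarith
    rw [le_div_iff₀ (mul_pos (one_sub_sq_pos_of_mem hz) (pow_pos h6 2))]
    calc _ = (H (r * σ)).re * ((1 - ‖z‖ ^ 2) * (1 - r ^ 2)) := by field_simp; ring
      _ ≤ _ := h1

/-- The kernel at `σ` equals `(1 + r) / (1 - r)` along its own radius and stays bounded near any
other point, so this normalization reads off the point mass. -/
lemma tendsto_one_sub_div_mul_herglotz {σ ζ : ℂ} (hσ : σ ∈ sphere (0 : ℂ) 1) :
    Tendsto (fun r : ℝ ↦ ((1 - r) / (1 + r) : ℂ) * ((ζ + r * σ) / (ζ - r * σ))) (𝓝[<] 1)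
      (𝓝 (if ζ = σ then 1 else 0)) := by
  have hσ0 : σ ≠ 0 := by rintro rfl; simp at hσ
  split_ifs with h
  · subst h
    refine tendsto_const_nhds.congr' ?_
    filter_upwards [eventually_mem_Ioo_zero_one] with r hr
    have h1 : (1 - r : ℂ) ≠ 0 := by
      exact_mod_cast (by linarith : (1 - r : ℝ) ≠ 0)
    have h2 : (1 + r : ℂ) ≠ 0 := by
      exact_mod_cast (by linarith : (1 + r : ℝ) ≠ 0)
    have : ζ - r * ζ ≠ 0 := by
      rw [show ζ - r * ζ = (1 - r) * ζ by ring]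
      exact mul_ne_zero h1 hσ0
    rw [div_mul_div_comm, eq_comm, div_eq_one_iff_eq (mul_ne_zero h2 this)]
    ring
  · have hc : ContinuousAt
        (fun r : ℝ ↦ ((1 - r) / (1 + r) : ℂ) * ((ζ + r * σ) / (ζ - r * σ))) 1 := by
      refine ContinuousAt.mul (ContinuousAt.div (by fun_prop) (by fun_prop) (by norm_num))
        (ContinuousAt.div (by fun_prop) (by fun_prop) (by simpa [sub_eq_zero] using h))
    simpa using hc.tendsto.mono_left (nhdsWithin_le_nhds (s := Set.Iio 1))

lemma differentiableOn_herglotz {σ : ℂ} (hσ : σ ∈ sphere (0 : ℂ) 1) :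
    DifferentiableOn ℂ (fun z ↦ (σ + z) / (σ - z)) (ball 0 1) :=
  DifferentiableOn.div (by fun_prop) (by fun_prop)
    fun _ hz ↦ norm_pos_iff.1 (norm_sub_pos_of_mem hσ hz)

/-- The Julia–Carathéodory theorem for the half plane. -/
lemma julia_caratheodory_halfPlane {H : ℂ → ℂ} (hd : DifferentiableOn ℂ H (ball 0 1))
    (hre : ∀ z ∈ ball (0 : ℂ) 1, 0 ≤ (H z).re) {σ : ℂ} (hσ : σ ∈ sphere (0 : ℂ) 1) :
    ∃ c : ℝ, 0 ≤ c ∧ (∀ z ∈ ball (0 : ℂ) 1, c * ((1 - ‖z‖ ^ 2) / ‖σ - z‖ ^ 2) ≤ (H z).re) ∧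
      Tendsto (fun r : ℝ ↦ ((1 - r) / (1 + r) : ℂ) * H (r * σ)) (𝓝[<] 1) (𝓝 (c : ℂ)) := by
  obtain ⟨c, hc0, hc, hlim⟩ := julia_halfPlane_re hd hre hσ
  refine ⟨c, hc0, hc, ?_⟩
  have hσ1 : ‖σ‖ = 1 := by simpa using hσ
  -- Without its mass at `σ`, the function has normalized real part tending to 0; Schwarz–Pick
  -- bounds the whole increment `K - K 0` by that real part, so the imaginary part goes to 0 as
  -- well.
  set K : ℂ → ℂ := fun z ↦ H z - c * ((σ + z) / (σ - z)) with hK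
  have hKd : DifferentiableOn ℂ K (ball 0 1) :=
    hd.sub ((differentiableOn_herglotz hσ).const_mul _)
  have hKre : ∀ z ∈ ball (0 : ℂ) 1, 0 ≤ (K z).re := by
    intro z hz
    have := hc z hz
    simp only [hK, Complex.sub_re, Complex.re_ofReal_mul, re_add_div_sub, hσ1]
    linarith
  have hP := tendsto_one_sub_div_mul_herglotz (ζ := σ) hσ
  rw [if_pos rfl] at hP
  have hKlim : Tendsto (fun r : ℝ ↦ (1 - r) / (1 + r) * (K (r * σ)).re) (𝓝[<] 1) (𝓝 0) := by
    have h1 := (Complex.continuous_re.tendsto _).comp hP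
    have h2 := hlim.sub (h1.const_mul c)
    simp only [Complex.one_re, mul_one, sub_self] at h2
    refine h2.congr fun r ↦ ?_
    have : ((1 - r) / (1 + r) : ℂ) = (((1 - r) / (1 + r) : ℝ) : ℂ) := by push_cast; rfl
    simp only [Function.comp_apply, this, Complex.re_ofReal_mul, hK, Complex.sub_re]
    ring
  have hKsq : Tendsto (fun r : ℝ ↦ (‖((1 - r) / (1 + r) : ℂ) * (K (r * σ) - K 0)‖ ^ 2))
      (𝓝[<] 1) (𝓝 0) := by
    have hb := hKlim.mul_const (4 * (K 0).re)
    rw [zero_mul] at hb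
    refine squeeze_zero' (Eventually.of_forall fun r ↦ by positivity) ?_ hb
    filter_upwards [eventually_mem_Ioo_zero_one] with r hr
    have hm := ofReal_mul_mem_ball hσ hr.1 hr.2
    have h1 := schwarz_pick_halfPlane hKd hKre hm (mem_ball_self one_pos)
    have h3 : ‖(r : ℂ) * σ‖ = r := by
      rw [norm_mul, hσ1, Complex.norm_real, Real.norm_of_nonneg hr.1.le, mul_one]
    have h5 : 0 < 1 - r := by linarith
    have h6 : 0 < 1 + r := by linarith
    simp only [sub_zero, h3, norm_zero, ne_eq, OfNat.ofNat_ne_zero, not_false_eq_true,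
      zero_pow, mul_one] at h1
    have h7 : ‖((1 - r) / (1 + r) : ℂ)‖ = (1 - r) / (1 + r) := by
      rw [show ((1 - r) / (1 + r) : ℂ) = (((1 - r) / (1 + r) : ℝ) : ℂ) by push_cast; rfl,
        Complex.norm_real, Real.norm_of_nonneg (by positivity)]
    rw [norm_mul, h7, mul_pow]
    have hx := hKre _ hm
    have hy := hKre 0 (by simp)
    have h8 : ‖K (r * σ) - K 0‖ ^ 2 * (1 - r ^ 2) ≤ 4 * (K (r * σ)).re * (K 0).re := by
      refine h1.trans ?_
      have : r ^ 2 ≤ 1 := by nlinarith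
      nlinarith [mul_nonneg hx hy]
    have h9 : 0 ≤ ‖K (r * σ) - K 0‖ ^ 2 * (1 - r) * r := by
      have := hr.1
      positivity
    have h10 : ‖K (r * σ) - K 0‖ ^ 2 * (1 - r) ≤ 4 * (K (r * σ)).re * (K 0).re := by
      nlinarith
    calc _ = ((1 - r) / (1 + r) * (‖K (r * σ) - K 0‖ ^ 2 * (1 - r))) * (1 / (1 + r)) := by
          field_simp
      _ ≤ ((1 - r) / (1 + r) * (4 * (K (r * σ)).re * (K 0).re)) * 1 := by
          gcongr
          · rw [div_le_one h6]; linarith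
      _ = _ := by ring
  have hK0 : Tendsto (fun r : ℝ ↦ ((1 - r) / (1 + r) : ℂ) * (K (r * σ) - K 0)) (𝓝[<] 1)
      (𝓝 0) := by
    rw [tendsto_zero_iff_norm_tendsto_zero]
    have := (Real.continuous_sqrt.tendsto 0).comp hKsq
    simpa only [Function.comp_def, Real.sqrt_sq (norm_nonneg _), Real.sqrt_zero] using this
  have hz : Tendsto (fun r : ℝ ↦ ((1 - r) / (1 + r) : ℂ) * K 0) (𝓝[<] 1) (𝓝 0) := by
    have hc : ContinuousAt (fun r : ℝ ↦ ((1 - r) / (1 + r) : ℂ) * K 0) 1 :=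
      ContinuousAt.mul (ContinuousAt.div (by fun_prop) (by fun_prop) (by norm_num)) (by fun_prop)
    simpa using hc.tendsto.mono_left (nhdsWithin_le_nhds (s := Set.Iio 1))
  have := (hK0.add hz).add (hP.const_mul (c : ℂ))
  simp only [add_zero, mul_one, zero_add] at this
  refine this.congr fun r ↦ ?_
  simp only [hK]
  ring

/-! ### The dilation coefficient as an angular derivative -/

lemma sub_ne_zero_of_mem {τ w : ℂ} (hτ : τ ∈ sphere (0 : ℂ) 1) (hw : w ∈ ball (0 : ℂ) 1) :
    τ - w ≠ 0 :=
  norm_pos_iff.1 (norm_sub_pos_of_mem hτ hw)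

lemma differentiableOn_cayley {f : ℂ → ℂ} (hf : IsDiskSelfMap f) {τ : ℂ}
    (hτ : τ ∈ sphere (0 : ℂ) 1) :
    DifferentiableOn ℂ (fun z ↦ (τ + f z) / (τ - f z)) (ball 0 1) :=
  (hf.1.const_add _).div (hf.1.const_sub _) fun _ hz ↦ sub_ne_zero_of_mem hτ (hf.2 hz)

lemma cayley_re_pos {f : ℂ → ℂ} (hf : IsDiskSelfMap f) {τ : ℂ} (hτ : τ ∈ sphere (0 : ℂ) 1)
    {z : ℂ} (hz : z ∈ ball (0 : ℂ) 1) : 0 < ((τ + f z) / (τ - f z)).re := by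
  rw [re_add_div_sub, show ‖τ‖ = 1 by simpa using hτ, one_pow]
  exact div_pos (one_sub_sq_pos_of_mem (hf.2 hz)) (pow_pos (norm_sub_pos_of_mem hτ (hf.2 hz)) 2)

/-- The quotient defining the dilation is the Poisson kernel over the real part of a Cayley
transform, so its supremum is the reciprocal of Julia's constant. -/
lemma dilationQuotient_eq {f : ℂ → ℂ} {σ τ z : ℂ} (hτ : τ ∈ sphere (0 : ℂ) 1) :
    (‖τ - f z‖ ^ 2 / (1 - ‖f z‖ ^ 2)) / (‖σ - z‖ ^ 2 / (1 - ‖z‖ ^ 2)) =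
      ((1 - ‖z‖ ^ 2) / ‖σ - z‖ ^ 2) / ((τ + f z) / (τ - f z)).re := by
  rw [re_add_div_sub, show ‖τ‖ = 1 by simpa using hτ, one_pow, div_div_div_eq, div_div_div_eq,
    mul_comm, mul_comm (_ - _) (‖σ - z‖ ^ 2), mul_comm (‖σ - z‖ ^ 2)]

/-- The boundary dilation coefficient is the reciprocal of the radial limit of the normalized
Cayley transform. -/
lemma tendsto_cayley_of_boundaryDilationAt_lt_top {f : ℂ → ℂ} (hf : IsDiskSelfMap f) {σ τ : ℂ}
    (hσ : σ ∈ sphere (0 : ℂ) 1) (hτ : τ ∈ sphere (0 : ℂ) 1) (h : boundaryDilationAt f σ τ < ⊤) :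
    0 < (boundaryDilationAt f σ τ).toReal ∧
    Tendsto (fun r : ℝ ↦ ((1 - r) / (1 + r) : ℂ) * ((τ + f (r * σ)) / (τ - f (r * σ)))) (𝓝[<] 1)
      (𝓝 (((boundaryDilationAt f σ τ).toReal⁻¹ : ℝ) : ℂ)) := by
  obtain ⟨c, hc0, hc, hlim⟩ := julia_caratheodory_halfPlane (differentiableOn_cayley hf hτ)
    (fun z hz ↦ (cayley_re_pos hf hτ hz).le) hσ
  have hP : ∀ z ∈ ball (0 : ℂ) 1, 0 < (1 - ‖z‖ ^ 2) / ‖σ - z‖ ^ 2 := fun z hz ↦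
    div_pos (one_sub_sq_pos_of_mem hz) (pow_pos (norm_sub_pos_of_mem hσ hz) 2)
  set b := (boundaryDilationAt f σ τ).toReal with hb
  have hle : ∀ z ∈ ball (0 : ℂ) 1,
      ((1 - ‖z‖ ^ 2) / ‖σ - z‖ ^ 2) / ((τ + f z) / (τ - f z)).re ≤ b := by
    intro z hz
    rw [← dilationQuotient_eq hτ]
    refine (ENNReal.ofReal_le_iff_le_toReal h.ne).1 ?_
    exact le_iSup₂ (f := fun z (_ : z ∈ ball (0 : ℂ) 1) ↦
      ENNReal.ofReal ((‖τ - f z‖ ^ 2 / (1 - ‖f z‖ ^ 2)) / (‖σ - z‖ ^ 2 / (1 - ‖z‖ ^ 2)))) z hz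
  have h0 : (0 : ℂ) ∈ ball (0 : ℂ) 1 := mem_ball_self one_pos
  have hbpos : 0 < b := (div_pos (hP 0 h0) (cayley_re_pos hf hτ h0)).trans_le (hle 0 h0)
  have hbc : b⁻¹ ≤ c := by
    have hre := (Complex.continuous_re.tendsto _).comp hlim
    refine ge_of_tendsto hre ?_
    have hσ1 : ‖σ‖ = 1 := by simpa using hσ
    filter_upwards [eventually_mem_Ioo_zero_one] with r hr
    have hm := ofReal_mul_mem_ball hσ hr.1 hr.2
    have h1 := hle _ hm
    have h2 : ‖σ - r * σ‖ = 1 - r := by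
      rw [show σ - r * σ = ((1 - r : ℝ) : ℂ) * σ by push_cast; ring, norm_mul, hσ1,
        Complex.norm_real, Real.norm_of_nonneg (by linarith), mul_one]
    have h3 : ‖(r : ℂ) * σ‖ = r := by
      rw [norm_mul, hσ1, Complex.norm_real, Real.norm_of_nonneg hr.1.le, mul_one]
    have h5 : 0 < 1 - r := by linarith
    have h6 : 0 < 1 + r := by linarith
    rw [h2, h3, div_le_iff₀ (cayley_re_pos hf hτ hm)] at h1
    simp only [Function.comp_apply]
    rw [show ((1 - r) / (1 + r) : ℂ) = (((1 - r) / (1 + r) : ℝ) : ℂ) by push_cast; rfl,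
      Complex.re_ofReal_mul, inv_le_iff_one_le_mul₀ hbpos]
    calc (1 : ℝ) = (1 - r) / (1 + r) * ((1 - r ^ 2) / (1 - r) ^ 2) := by field_simp; ring
      _ ≤ (1 - r) / (1 + r) * (b * ((τ + f (r * σ)) / (τ - f (r * σ))).re) := by gcongr
      _ = _ := by ring
  have hcpos : 0 < c := (inv_pos.2 hbpos).trans_le hbc
  -- Julia's inequality bounds every quotient by `c⁻¹`; the reverse comparison above came from
  -- testing along the radius.
  have hcb : b ≤ c⁻¹ := by
    refine ENNReal.toReal_le_of_le_ofReal (by positivity) (iSup₂_le fun z hz ↦ ?_)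
    refine ENNReal.ofReal_le_ofReal ?_
    rw [dilationQuotient_eq hτ, div_le_iff₀ (cayley_re_pos hf hτ hz)]
    have := hc z hz
    rwa [← div_eq_inv_mul, le_div_iff₀' hcpos]
  have : c = b⁻¹ := le_antisymm ((le_inv_comm₀ hbpos hcpos).1 hcb) hbc
  exact ⟨hbpos, this ▸ hlim⟩

lemma tendsto_one_sub_ofReal : Tendsto (fun r : ℝ ↦ (1 - r : ℂ)) (𝓝[<] 1) (𝓝 0) := by
  have hc : ContinuousAt (fun r : ℝ ↦ (1 - r : ℂ)) 1 := by fun_prop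
  convert hc.tendsto.mono_left (nhdsWithin_le_nhds (s := Set.Iio 1)) using 2
  norm_num

/-- If `C` is the normalized Cayley transform, then `(C * (1 + r) + (1 - r)) / (2 * τ) = (1 - r) /
(τ - w r)`; invert. -/
lemma tendsto_sub_div_of_tendsto_cayley {τ c : ℂ} {w : ℝ → ℂ} (hτ : τ ≠ 0) (hc : c ≠ 0)
    (hw : ∀ᶠ r in 𝓝[<] (1 : ℝ), τ - w r ≠ 0)
    (h : Tendsto (fun r : ℝ ↦ ((1 - r) / (1 + r) : ℂ) * ((τ + w r) / (τ - w r))) (𝓝[<] 1) (𝓝 c)) :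
    Tendsto (fun r : ℝ ↦ (τ - w r) / (1 - r)) (𝓝[<] 1) (𝓝 (τ / c)) := by
  have h1 : Tendsto (fun r : ℝ ↦ (1 + r : ℂ)) (𝓝[<] 1) (𝓝 2) := by
    have hc : ContinuousAt (fun r : ℝ ↦ (1 + r : ℂ)) 1 := by fun_prop
    convert hc.tendsto.mono_left (nhdsWithin_le_nhds (s := Set.Iio 1)) using 2
    norm_num
  have h3 := (((h.mul h1).add tendsto_one_sub_ofReal).div_const (2 * τ)).inv₀
    (by simp [hc, hτ])
  convert h3.congr' ?_ using 2
  · field_simp; ring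
  · filter_upwards [hw, eventually_mem_Ioo_zero_one] with r hr hr'
    have h5 : (1 - r : ℂ) ≠ 0 := by exact_mod_cast (by linarith : (1 - r : ℝ) ≠ 0)
    have h6 : (1 + r : ℂ) ≠ 0 := by exact_mod_cast (by linarith : (1 + r : ℝ) ≠ 0)
    rw [inv_eq_iff_eq_inv, inv_div]
    field_simp
    ring

lemma tendsto_radial_sub_div {f : ℂ → ℂ} (hf : IsDiskSelfMap f) {σ τ : ℂ}
    (hσ : σ ∈ sphere (0 : ℂ) 1) (hτ : τ ∈ sphere (0 : ℂ) 1) (h : boundaryDilationAt f σ τ < ⊤) :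
    Tendsto (fun r : ℝ ↦ (τ - f (r * σ)) / (1 - r)) (𝓝[<] 1)
      (𝓝 (τ * (boundaryDilationAt f σ τ).toReal)) := by
  obtain ⟨h0, h1⟩ := tendsto_cayley_of_boundaryDilationAt_lt_top hf hσ hτ h
  have hτ0 : τ ≠ 0 := by rintro rfl; simp at hτ
  have := tendsto_sub_div_of_tendsto_cayley hτ0 (w := fun r ↦ f (r * σ))
    (by simpa using h0.ne') ?_ h1
  · simpa using this
  · filter_upwards [eventually_mem_Ioo_zero_one] with r hr
    exact sub_ne_zero_of_mem hτ (hf.2 (ofReal_mul_mem_ball hσ hr.1 hr.2))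

lemma tendsto_of_tendsto_sub_div {τ d : ℂ} {w : ℝ → ℂ}
    (h : Tendsto (fun r : ℝ ↦ (τ - w r) / (1 - r)) (𝓝[<] 1) (𝓝 d)) :
    Tendsto w (𝓝[<] 1) (𝓝 τ) := by
  have h1 := (h.mul tendsto_one_sub_ofReal).const_sub τ
  simp only [mul_zero, sub_zero] at h1
  refine h1.congr' ?_
  filter_upwards [eventually_mem_Ioo_zero_one] with r hr
  have h5 : (1 - r : ℂ) ≠ 0 := by exact_mod_cast (by linarith : (1 - r : ℝ) ≠ 0)
  rw [div_mul_cancel₀ _ h5, sub_sub_cancel]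

/-- A `τ` with finite dilation has a convergent difference quotient and is therefore the radial
limit of `f`, so only one `τ` counts in the infimum. -/
lemma boundaryDilation_eq_boundaryDilationAt {f : ℂ → ℂ} (hf : IsDiskSelfMap f) {σ τ : ℂ}
    (hσ : σ ∈ sphere (0 : ℂ) 1) (h : boundaryDilation f σ < ⊤)
    (hlim : Tendsto (fun r : ℝ ↦ f (r * σ)) (𝓝[<] 1) (𝓝 τ)) :
    τ ∈ sphere (0 : ℂ) 1 ∧ boundaryDilation f σ = boundaryDilationAt f σ τ := by
  have huniq : ∀ τ' ∈ sphere (0 : ℂ) 1, boundaryDilationAt f σ τ' < ⊤ → τ' = τ := fun τ' hτ' h' ↦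
    tendsto_nhds_unique
      (tendsto_of_tendsto_sub_div (tendsto_radial_sub_div hf hσ hτ' h')) hlim
  have hmem : τ ∈ sphere (0 : ℂ) 1 := by
    simp only [boundaryDilation, iInf_lt_iff] at h
    obtain ⟨τ', hτ', h'⟩ := h
    exact huniq τ' hτ' h' ▸ hτ'
  refine ⟨hmem, le_antisymm (iInf₂_le τ hmem) (le_iInf₂ fun τ' hτ' ↦ ?_)⟩
  by_cases htop : boundaryDilationAt f σ τ' < ⊤
  · rw [huniq τ' hτ' htop]
  · rw [not_lt_top_iff.1 htop]
    exact le_top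

lemma HasNonTangentialLimit.tendsto_radial {f : ℂ → ℂ} {σ c : ℂ} (hσ : σ ∈ sphere (0 : ℂ) 1)
    (h : HasNonTangentialLimit f σ c) : Tendsto (fun r : ℝ ↦ f (r * σ)) (𝓝[<] 1) (𝓝 c) := by
  refine (h 2 (by norm_num)).comp (tendsto_nhdsWithin_iff.2 ⟨?_, ?_⟩)
  · have hc : ContinuousAt (fun r : ℝ ↦ (r * σ : ℂ)) 1 := by fun_prop
    simpa using hc.tendsto.mono_left (nhdsWithin_le_nhds (s := Set.Iio 1))
  · have hσ1 : ‖σ‖ = 1 := by simpa using hσ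
    filter_upwards [eventually_mem_Ioo_zero_one] with r hr
    refine ⟨ofReal_mul_mem_ball hσ hr.1 hr.2, ?_⟩
    have h2 : ‖σ - r * σ‖ = 1 - r := by
      rw [show σ - r * σ = ((1 - r : ℝ) : ℂ) * σ by push_cast; ring, norm_mul, hσ1,
        Complex.norm_real, Real.norm_of_nonneg (by linarith), mul_one]
    have h3 : ‖(r : ℂ) * σ‖ = r := by
      rw [norm_mul, hσ1, Complex.norm_real, Real.norm_of_nonneg hr.1.le, mul_one]
    rw [h2, h3, div_self (by linarith)]
    norm_num

/-! ### Dividing by `z ^ k` -/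

/-- If `f = z ^ k * g` and `f` has radial limit `σ ^ k` at `σ` with finite dilation `b`, then the
Herglotz function `(1 + g) / (1 - g)` has the mass `1 / (b - k)` at `σ`. -/
lemma tendsto_cayley_quotient {f g : ℂ → ℂ} (hf : IsDiskSelfMap f) (hg : IsDiskSelfMap g) {k : ℕ}
    (hfg : ∀ z ∈ ball (0 : ℂ) 1, f z = z ^ k * g z) {σ : ℂ} (hσ : σ ∈ sphere (0 : ℂ) 1)
    (h : boundaryDilation f σ < ⊤)
    (hlim : Tendsto (fun r : ℝ ↦ f (r * σ)) (𝓝[<] 1) (𝓝 (σ ^ k))) :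
    (k : ℝ) < (boundaryDilation f σ).toReal ∧
    Tendsto (fun r : ℝ ↦ ((1 - r) / (1 + r) : ℂ) * ((1 + g (r * σ)) / (1 - g (r * σ)))) (𝓝[<] 1)
      (𝓝 (((1 / ((boundaryDilation f σ).toReal - k) : ℝ)) : ℂ)) := by
  obtain ⟨hmem, heq⟩ := boundaryDilation_eq_boundaryDilationAt hf hσ h hlim
  rw [heq] at h ⊢
  set b := (boundaryDilationAt f σ (σ ^ k)).toReal
  have h1 := tendsto_radial_sub_div hf hσ hmem h
  have hσ0 : σ ≠ 0 := by rintro rfl; simp at hσ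
  have hσk : σ ^ k ≠ 0 := pow_ne_zero _ hσ0
  have h2 : Tendsto (fun r : ℝ ↦ (1 - r ^ k * g (r * σ) : ℂ) / (1 - r)) (𝓝[<] 1) (𝓝 b) := by
    have := h1.div_const (σ ^ k)
    rw [mul_div_cancel_left₀ _ hσk] at this
    refine this.congr' ?_
    filter_upwards [eventually_mem_Ioo_zero_one] with r hr
    rw [hfg _ (ofReal_mul_mem_ball hσ hr.1 hr.2), mul_pow]
    field_simp
  have hr : ∀ m : ℕ, Tendsto (fun r : ℝ ↦ (r ^ m : ℂ)) (𝓝[<] 1) (𝓝 1) := by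
    intro m
    have hc : ContinuousAt (fun r : ℝ ↦ (r ^ m : ℂ)) 1 := by fun_prop
    simpa using hc.tendsto.mono_left (nhdsWithin_le_nhds (s := Set.Iio 1))
  have hG : Tendsto (fun r : ℝ ↦ g (r * σ)) (𝓝[<] 1) (𝓝 1) := by
    have := (tendsto_of_tendsto_sub_div h2).div (hr k) one_ne_zero
    rw [div_one] at this
    refine this.congr' ?_
    filter_upwards [eventually_mem_Ioo_zero_one] with r hr
    have : (r : ℂ) ≠ 0 := by exact_mod_cast hr.1.ne'
    simp only [Pi.div_apply]
    rw [mul_div_cancel_left₀ _ (pow_ne_zero _ this)]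
  have hgeom : Tendsto (fun r : ℝ ↦ (1 - r ^ k : ℂ) / (1 - r)) (𝓝[<] 1) (𝓝 k) := by
    have := tendsto_finsetSum (Finset.range k) fun i _ ↦ hr i
    simp only [Finset.sum_const, Finset.card_range, nsmul_eq_mul, mul_one] at this
    refine this.congr' ?_
    filter_upwards [eventually_mem_Ioo_zero_one] with r hr
    have h5 : (1 - r : ℂ) ≠ 0 := by exact_mod_cast (by linarith : (1 - r : ℝ) ≠ 0)
    rw [eq_div_iff h5, geom_sum_mul_neg]
  -- Product rule: `(1 - r ^ k * G) - G * (1 - r ^ k) = 1 - G`.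
  have h3 : Tendsto (fun r : ℝ ↦ (1 - g (r * σ) : ℂ) / (1 - r)) (𝓝[<] 1) (𝓝 (b - k)) := by
    have := h2.sub (hG.mul hgeom)
    rw [one_mul] at this
    refine this.congr fun r ↦ ?_
    ring
  have hone : (1 : ℂ) ∈ sphere (0 : ℂ) 1 := by simp
  obtain ⟨c, hc0, -, hc⟩ := julia_caratheodory_halfPlane (differentiableOn_cayley hg hone)
    (fun z hz ↦ (cayley_re_pos hg hone hz).le) hσ
  have h4 : Tendsto (fun r : ℝ ↦ (1 + g (r * σ) : ℂ) / (1 + r ^ 1)) (𝓝[<] 1) (𝓝 1) := by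
    have := (hG.const_add 1).div ((hr 1).const_add 1) (by norm_num)
    rwa [div_self (by norm_num)] at this
  -- The factors `1 - r` and `1 - g` cancel, leaving `(1 + g) / (1 + r)`. This excludes `b = k`, and
  -- `0 ≤ c` then gives `k < b`.
  have h5 : (c * (b - k) : ℂ) = 1 := by
    refine tendsto_nhds_unique ((hc.mul h3).congr' ?_) h4
    filter_upwards [eventually_mem_Ioo_zero_one] with r hr
    have h5 : (1 - r : ℂ) ≠ 0 := by exact_mod_cast (by linarith : (1 - r : ℝ) ≠ 0)
    have h6 : (1 + r : ℂ) ≠ 0 := by exact_mod_cast (by linarith : (1 + r : ℝ) ≠ 0)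
    have h7 := sub_ne_zero_of_mem hone (hg.2 (ofReal_mul_mem_ball hσ hr.1 hr.2))
    field_simp
  have h6 : c * (b - k) = 1 := by exact_mod_cast h5
  have h7 : 0 < b - k := by
    by_contra! hneg
    nlinarith
  refine ⟨by linarith, ?_⟩
  rwa [← eq_one_div_of_mul_eq_one_left h6]

/-- A rational function `p / q` with unimodular boundary values, all of whose zeros lie in the disk,
is a finite Blaschke product. -/
lemma isBlaschkeProduct_of_rational {f : ℂ → ℂ} {p q : Polynomial ℂ} (hp : p ≠ 0)
    (hroots : ∀ z, p.eval z = 0 → z ∈ ball (0 : ℂ) 1)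
    (hq : ∀ z ∈ closedBall (0 : ℂ) 1, q.eval z ≠ 0)
    (hnorm : ∀ z ∈ sphere (0 : ℂ) 1, ‖p.eval z‖ = ‖q.eval z‖)
    (hf : ∀ z ∈ ball (0 : ℂ) 1, f z = p.eval z / q.eval z) :
    IsBlaschkeProduct p.natDegree f := by
  have hq' : ∀ z ∈ ball (0 : ℂ) 1, q.eval z ≠ 0 := fun z hz ↦ hq z (ball_subset_closedBall hz)
  refine ⟨?_, ⟨fun z ↦ p.eval z / q.eval z, ?_, fun z hz ↦ (hf z hz).symm, ?_⟩, p.roots, ?_, ?_, ?_⟩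
  · refine DifferentiableOn.congr ?_ hf
    exact p.differentiable.differentiableOn.div q.differentiable.differentiableOn hq'
  · exact p.continuous.continuousOn.div q.continuous.continuousOn hq
  · intro z hz
    rw [mem_sphere_zero_iff_norm, norm_div, hnorm z hz, div_self]
    exact norm_ne_zero_iff.2 (hq z (sphere_subset_closedBall hz))
  · exact (IsAlgClosed.splits p).natDegree_eq_card_roots.symm
  · intro a ha
    exact hroots a (Polynomial.isRoot_of_mem_roots ha)
  · intro z hz
    rw [Polynomial.count_roots]
    obtain ⟨u, hu, hdvd⟩ := Polynomial.exists_eq_pow_rootMultiplicity_mul_and_not_dvd p hp z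
    have hev : f =ᶠ[𝓝 z] fun w ↦ (w - z) ^ (p.rootMultiplicity z) • (u.eval w / q.eval w) := by
      filter_upwards [isOpen_ball.mem_nhds hz] with w hw
      rw [hf w hw]
      conv_lhs => rw [hu]
      simp [mul_div_assoc]
    have huq : AnalyticAt ℂ (fun w ↦ u.eval w / q.eval w) z :=
      AnalyticAt.div (u.differentiable.analyticAt z) (q.differentiable.analyticAt z) (hq' z hz)
    have hfa : AnalyticAt ℂ f z := by
      refine AnalyticAt.congr ?_ hev.symm
      fun_prop
    refine hfa.analyticOrderAt_eq_natCast.2 ⟨_, huq, ?_, hev⟩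
    refine div_ne_zero (fun h ↦ hdvd ?_) (hq' z hz)
    exact Polynomial.dvd_iff_isRoot.2 h

/-- A self-map of the disk vanishing to order `k` at the origin is `z ^ k` times a function bounded
by one. -/
lemma exists_eq_pow_mul {f : ℂ → ℂ} (hf : IsDiskSelfMap f) {k : ℕ} (hk : 1 ≤ k)
    (h0 : ∀ i : ℕ, i < k → iteratedDeriv i f 0 = 0) :
    ∃ g : ℂ → ℂ, DifferentiableOn ℂ g (ball 0 1) ∧ (∀ z, f z = z ^ k * g z) ∧
      g 0 = iteratedDeriv k f 0 / (k.factorial : ℂ) ∧ ∀ z ∈ ball (0 : ℂ) 1, ‖g z‖ ≤ 1 := by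
  have hfa : AnalyticAt ℂ f 0 := hf.1.analyticAt (ball_mem_nhds 0 one_pos)
  -- Expanding to order `k + 1` exhibits the value `a` of the quotient at 0. Away from 0,
  -- differentiability comes from `f / z ^ k`.
  obtain ⟨F, hFa, hF⟩ := hfa.exists_eq_sum_add_pow_mul (k + 1)
  set a := iteratedDeriv k f 0 / (k.factorial : ℂ) with ha
  have hF' : ∀ z, f z = z ^ k * (a + z * F z) := by
    intro z
    rw [hF z, Finset.sum_range_succ, Finset.sum_eq_zero, smul_eq_mul, smul_eq_mul, ha]
    · ring
    · intro i hi
      rw [h0 i (Finset.mem_range.1 hi), smul_zero]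
  have hga : AnalyticAt ℂ (fun z ↦ a + z * F z) 0 := by fun_prop
  have hgd : DifferentiableOn ℂ (fun z ↦ a + z * F z) (ball 0 1) := by
    intro z hz
    by_cases hz0 : z = 0
    · rw [hz0]
      exact hga.differentiableAt.differentiableWithinAt
    · have h1 : DifferentiableAt ℂ (fun z ↦ f z / z ^ k) z :=
        (hf.1.differentiableAt (isOpen_ball.mem_nhds hz)).div (by fun_prop) (pow_ne_zero _ hz0)
      refine (h1.congr_of_eventuallyEq ?_).differentiableWithinAt
      filter_upwards [isOpen_ne.mem_nhds hz0] with w hw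
      rw [hF' w, mul_div_cancel_left₀ _ (pow_ne_zero _ hw)]
  have hf0 : f 0 = 0 := by simpa using h0 0 (by omega)
  have hle : ∀ z ∈ ball (0 : ℂ) 1, z ≠ 0 → ‖a + z * F z‖ ≤ 1 := by
    intro z hz hz0
    -- The higher-order Schwarz lemma turns `o(‖w‖ ^ (k - 1))` into the bound `‖z‖ ^ k`.
    have hO : (f · - f 0) =o[𝓝 0] (fun w ↦ ‖w - 0‖ ^ (k - 1)) := by
      have h1 : f = fun w ↦ w ^ k * (a + w * F w) := funext hF'
      have h2 : (fun w : ℂ ↦ w ^ k * (a + w * F w)) =O[𝓝 0] fun w ↦ w ^ k * (1 : ℂ) :=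
        (Asymptotics.isBigO_refl _ _).mul (hga.continuousAt.tendsto.isBigO_one ℂ)
      have h3 : (fun w : ℂ ↦ w ^ k) =o[𝓝 0] fun w ↦ w ^ (k - 1) :=
        Asymptotics.isLittleO_pow_pow (by omega)
      simp only [hf0, sub_zero]
      rw [h1]
      simp only [mul_one] at h2
      refine (h2.trans_isLittleO h3).trans_isBigO ?_
      simpa only [norm_pow] using (Asymptotics.isBigO_refl (fun w : ℂ ↦ w ^ (k - 1)) (𝓝 0)).norm_right
    have h1 := Complex.dist_le_mul_div_pow_of_mapsTo_ball_of_isLittleO (R₂ := 1) hf.1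
      (fun w hw ↦ by rw [hf0]; exact ball_subset_closedBall (hf.2 hw)) hO hz
    rw [hf0, dist_zero_right, dist_zero_right, hF' z, norm_mul, norm_pow, one_mul, div_one,
      Nat.sub_add_cancel hk] at h1
    exact le_of_mul_le_mul_left (by simpa using h1) (pow_pos (norm_pos_iff.2 hz0) k)
  refine ⟨fun z ↦ a + z * F z, hgd, hF', by simp, fun z hz ↦ ?_⟩
  by_cases hz0 : z = 0
  · subst hz0
    have ht : Tendsto (fun z ↦ ‖a + z * F z‖) (𝓝[≠] 0) (𝓝 ‖a + 0 * F 0‖) :=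
      hga.continuousAt.norm.tendsto.mono_left nhdsWithin_le_nhds
    refine le_of_tendsto ht ?_
    filter_upwards [self_mem_nhdsWithin, nhdsWithin_le_nhds (ball_mem_nhds (0 : ℂ) one_pos)]
      with w hw hw' using hle w hw' hw
  · exact hle z hz hz0

/-- If `‖g‖` reached 1 inside the disk, the maximum principle would make `g` a unimodular constant
and `f` a Blaschke product of degree `k`. -/
lemma isDiskSelfMap_quotient {f g : ℂ → ℂ} {k : ℕ} (hg : DifferentiableOn ℂ g (ball 0 1))
    (hfg : ∀ z, f z = z ^ k * g z) (hle : ∀ z ∈ ball (0 : ℂ) 1, ‖g z‖ ≤ 1)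
    (hB : ¬ IsBlaschkeProduct k f) : IsDiskSelfMap g := by
  refine ⟨hg, fun v hv ↦ ?_⟩
  rw [mem_ball_zero_iff]
  refine (hle v hv).lt_of_ne fun h1 ↦ hB ?_
  have hconst := Complex.eq_const_of_exists_max hg hv
    (fun w hw ↦ by simpa [h1] using hle w hw)
  have hc : g v ≠ 0 := norm_ne_zero_iff.1 (by rw [h1]; exact one_ne_zero)
  have := isBlaschkeProduct_of_rational (f := f) (p := Polynomial.C (g v) * Polynomial.X ^ k)
    (q := 1) (by simp [hc]) ?_ (by simp) ?_ ?_
  · rwa [Polynomial.natDegree_C_mul_X_pow k _ hc] at this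
  · intro z hz
    simp only [Polynomial.eval_mul, Polynomial.eval_C, Polynomial.eval_pow, Polynomial.eval_X,
      mul_eq_zero, hc, false_or] at hz
    simp [eq_zero_of_pow_eq_zero hz]
  · intro z hz
    have : ‖z‖ = 1 := by simpa using hz
    simp [this, h1]
  · intro z hz
    rw [hfg, hconst hz, Function.const_apply, mul_comm]
    simp only [Polynomial.eval_mul, Polynomial.eval_C, Polynomial.eval_pow, Polynomial.eval_X,
      Polynomial.eval_one, div_one]

/-! ### Splitting off point masses -/

/-- Each kernel has mass only at its own point: subtraction removes the masses indexed by `s` and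
leaves the others unchanged. -/
lemma tendsto_sub_sum_herglotz {ι : Type*} [DecidableEq ι] {H : ℂ → ℂ} {σ : ι → ℂ}
    (hσ : ∀ j, σ j ∈ sphere (0 : ℂ) 1) (hinj : Function.Injective σ) {c : ι → ℝ} {i : ι}
    (hlim : Tendsto (fun r : ℝ ↦ ((1 - r) / (1 + r) : ℂ) * H (r * σ i)) (𝓝[<] 1) (𝓝 (c i : ℂ)))
    (s : Finset ι) :
    Tendsto (fun r : ℝ ↦ ((1 - r) / (1 + r) : ℂ) *
      (H (r * σ i) - ∑ j ∈ s, c j * ((σ j + r * σ i) / (σ j - r * σ i)))) (𝓝[<] 1)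
      (𝓝 (if i ∈ s then 0 else (c i : ℂ))) := by
  have h1 := hlim.sub (tendsto_finsetSum s fun j _ ↦
    (tendsto_one_sub_div_mul_herglotz (ζ := σ j) (hσ i)).const_mul (c j : ℂ))
  convert h1.congr fun r ↦ ?_ using 2
  · simp only [hinj.eq_iff, mul_ite, mul_one, mul_zero, Finset.sum_ite_eq']
    split_ifs <;> simp
  · rw [mul_sub, Finset.mul_sum]
    congr 1
    exact Finset.sum_congr rfl fun j _ ↦ by ring

lemma differentiableOn_sub_sum_herglotz {ι : Type*} {H : ℂ → ℂ} {σ : ι → ℂ}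
    (hd : DifferentiableOn ℂ H (ball 0 1)) (hσ : ∀ j, σ j ∈ sphere (0 : ℂ) 1) (c : ι → ℝ)
    (s : Finset ι) :
    DifferentiableOn ℂ (fun z ↦ H z - ∑ j ∈ s, c j * ((σ j + z) / (σ j - z))) (ball 0 1) :=
  hd.sub (DifferentiableOn.fun_sum fun j _ ↦ (differentiableOn_herglotz (hσ j)).const_mul _)

/-- Point masses on the boundary can be split off a function of nonnegative real part. -/
lemma re_sub_sum_herglotz_nonneg {ι : Type*} {H : ℂ → ℂ} {σ : ι → ℂ}
    (hd : DifferentiableOn ℂ H (ball 0 1)) (hre : ∀ z ∈ ball (0 : ℂ) 1, 0 ≤ (H z).re)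
    (hσ : ∀ j, σ j ∈ sphere (0 : ℂ) 1) (hinj : Function.Injective σ) {c : ι → ℝ}
    (hlim : ∀ i, Tendsto (fun r : ℝ ↦ ((1 - r) / (1 + r) : ℂ) * H (r * σ i)) (𝓝[<] 1)
      (𝓝 (c i : ℂ))) (s : Finset ι) :
    ∀ z ∈ ball (0 : ℂ) 1, 0 ≤ (H z - ∑ j ∈ s, c j * ((σ j + z) / (σ j - z))).re := by
  classical
  induction s using Finset.induction_on with
  | empty => simpa using hre
  | insert i s hi ih =>
    obtain ⟨c', -, hc', hlim'⟩ := julia_caratheodory_halfPlane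
      (differentiableOn_sub_sum_herglotz hd hσ c s) ih (hσ i)
    have h1 := tendsto_sub_sum_herglotz hσ hinj (hlim i) s
    rw [if_neg hi] at h1
    -- Since `i ∉ s`, Julia's constant of the remainder at `σ i` is still the full mass.
    have h2 : c' = c i := by exact_mod_cast tendsto_nhds_unique hlim' h1
    intro z hz
    have h3 := hc' z hz
    have hσ1 : ‖σ i‖ = 1 := by simpa using hσ i
    rw [Finset.sum_insert hi, add_comm, ← sub_sub, Complex.sub_re, Complex.re_ofReal_mul,
      re_add_div_sub, hσ1, one_pow, ← h2]
    linarith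

/-- Schwarz–Pick against the point 0 has a vanishing right-hand side. -/
lemma eq_const_of_re_eq_zero {H : ℂ → ℂ} (hd : DifferentiableOn ℂ H (ball 0 1))
    (hre : ∀ z ∈ ball (0 : ℂ) 1, 0 ≤ (H z).re) (h0 : (H 0).re = 0) {z : ℂ}
    (hz : z ∈ ball (0 : ℂ) 1) : H z = H 0 := by
  have h1 := schwarz_pick_halfPlane hd hre hz (mem_ball_self one_pos)
  rw [h0, mul_zero, norm_zero] at h1
  have h2 := one_sub_sq_pos_of_mem hz
  have h3 : ‖H z - H 0‖ ^ 2 ≤ 0 := by nlinarith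
  rw [← sub_eq_zero, ← norm_eq_zero]
  exact pow_eq_zero_iff (two_ne_zero) |>.1 (le_antisymm h3 (sq_nonneg _))

/-! ### Finitely many point masses give a Blaschke product -/

/-- The numerator of `κ + ∑ j, c j * (σ j + z) / (σ j - z)` over the denominator
`∏ j, (z - σ j)`. -/
noncomputable def herglotzNumerator {n : ℕ} (σ : Fin n → ℂ) (c : Fin n → ℝ) (κ : ℂ) :
    Polynomial ℂ :=
  Polynomial.C (κ - ∑ j, (c j : ℂ)) * Lagrange.nodal Finset.univ σ -
    ∑ j, Polynomial.C (2 * c j * σ j) * Lagrange.nodal (Finset.univ.erase j) σ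

section

variable {n : ℕ} {σ : Fin n → ℂ} {c : Fin n → ℝ} {κ : ℂ}

lemma eval_nodal_univ_eq (z : ℂ) (j : Fin n) :
    (Lagrange.nodal Finset.univ σ).eval z =
      (z - σ j) * (Lagrange.nodal (Finset.univ.erase j) σ).eval z := by
  rw [Lagrange.nodal_eq_mul_nodal_erase (Finset.mem_univ j)]
  simp

/-- Partial fractions: `(σ + z) / (σ - z) = -1 - 2 * σ / (z - σ)`. -/
lemma eval_herglotzNumerator {z : ℂ} (hz : ∀ j, σ j - z ≠ 0) :
    (herglotzNumerator σ c κ).eval z =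
      (κ + ∑ j, c j * ((σ j + z) / (σ j - z))) * (Lagrange.nodal Finset.univ σ).eval z := by
  simp only [herglotzNumerator, Polynomial.eval_sub, Polynomial.eval_mul, Polynomial.eval_C,
    Polynomial.eval_finsetSum]
  rw [sub_mul, add_mul, Finset.sum_mul, Finset.sum_mul, sub_sub, ← Finset.sum_add_distrib,
    sub_eq_add_neg, ← Finset.sum_neg_distrib]
  congr 1
  refine Finset.sum_congr rfl fun j _ ↦ ?_
  have := hz j
  rw [eval_nodal_univ_eq z j]
  field_simp
  ring

lemma eval_herglotzNumerator_node (i : Fin n) :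
    (herglotzNumerator σ c κ).eval (σ i) =
      -(2 * c i * σ i * (Lagrange.nodal (Finset.univ.erase i) σ).eval (σ i)) := by
  simp only [herglotzNumerator, Polynomial.eval_sub, Polynomial.eval_mul, Polynomial.eval_C,
    Polynomial.eval_finsetSum, Lagrange.eval_nodal_at_node (Finset.mem_univ i), mul_zero, zero_sub]
  rw [Finset.sum_eq_single i]
  · intro j _ hj
    rw [Lagrange.eval_nodal_at_node (by simp [hj.symm]), mul_zero]
  · simp

lemma eval_nodal_univ_ne_zero {z : ℂ} (hz : ∀ j, σ j - z ≠ 0) :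
    (Lagrange.nodal Finset.univ σ).eval z ≠ 0 :=
  Lagrange.eval_nodal_not_at_node fun j _ h ↦ hz j (sub_eq_zero.2 h.symm)

lemma degree_sum_nodal_erase_lt (d : Fin n → ℂ) :
    (∑ j, Polynomial.C (d j) * Lagrange.nodal (Finset.univ.erase j) σ).degree < n := by
  rw [← Polynomial.mem_degreeLT]
  refine Submodule.sum_mem _ fun j _ ↦ ?_
  rw [Polynomial.C_mul']
  refine Submodule.smul_mem _ _ (Polynomial.mem_degreeLT.2 ?_)
  rw [Lagrange.degree_nodal, Finset.card_erase_of_mem (Finset.mem_univ j), Finset.card_univ,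
    Fintype.card_fin]
  have := j.pos
  exact_mod_cast (by omega : n - 1 < n)

/-- The coefficient of `z ^ n` is `κ - ∑ c j - 1`; the other terms have degree below `n`. -/
lemma natDegree_herglotzNumerator_sub (h : κ - ∑ j, (c j : ℂ) ≠ 1) :
    (herglotzNumerator σ c κ - Lagrange.nodal Finset.univ σ).natDegree = n := by
  have h1 : herglotzNumerator σ c κ - Lagrange.nodal Finset.univ σ =
      Polynomial.C (κ - ∑ j, (c j : ℂ) - 1) * Lagrange.nodal Finset.univ σ -
        ∑ j, Polynomial.C (2 * c j * σ j) * Lagrange.nodal (Finset.univ.erase j) σ := by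
    rw [herglotzNumerator, Polynomial.C_sub (a := κ - ∑ j, (c j : ℂ)) (b := 1), Polynomial.C_1]
    ring
  have h2 : (Polynomial.C (κ - ∑ j, (c j : ℂ) - 1) * Lagrange.nodal Finset.univ σ).degree = n := by
    rw [Polynomial.degree_C_mul (sub_ne_zero.2 h), Lagrange.degree_nodal, Finset.card_univ,
      Fintype.card_fin]
  rw [h1]
  refine Polynomial.natDegree_eq_of_degree_eq_some ?_
  rw [Polynomial.degree_sub_eq_left_of_degree_lt]
  · exact h2
  · rw [h2]
    exact degree_sum_nodal_erase_lt _

/-- For positive masses the sign is that of `1 - ‖z‖ ^ 2`; this locates the zeros of numerator minus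
denominator. -/
lemma re_sum_herglotz (hσ : ∀ j, σ j ∈ sphere (0 : ℂ) 1) (hκ : κ.re = 0) (z : ℂ) :
    (κ + ∑ j, c j * ((σ j + z) / (σ j - z))).re =
      ∑ j, c j * ((1 - ‖z‖ ^ 2) / ‖σ j - z‖ ^ 2) := by
  rw [Complex.add_re, hκ, zero_add, Complex.re_sum]
  refine Finset.sum_congr rfl fun j _ ↦ ?_
  rw [Complex.re_ofReal_mul, re_add_div_sub, show ‖σ j‖ = 1 by simpa using hσ j, one_pow]

lemma norm_sub_one_eq_norm_add_one {w : ℂ} (h : w.re = 0) : ‖w - 1‖ = ‖w + 1‖ := by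
  rw [← sq_eq_sq₀ (norm_nonneg _) (norm_nonneg _)]
  simp only [Complex.sq_norm, Complex.normSq_apply]
  simp [h]

/-- If the Cayley transform of `g` is a finite sum of point masses, then `z ^ k * g` is a finite
Blaschke product. -/
lemma isBlaschkeProduct_of_cayley_eq {f g : ℂ → ℂ} {k : ℕ} (hg : IsDiskSelfMap g)
    (hfg : ∀ z, f z = z ^ k * g z) (hσ : ∀ j, σ j ∈ sphere (0 : ℂ) 1)
    (hinj : Function.Injective σ) (hc : ∀ j, 0 < c j) (hκ : κ.re = 0)
    (hh : ∀ z ∈ ball (0 : ℂ) 1,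
      (1 + g z) / (1 - g z) = κ + ∑ j, c j * ((σ j + z) / (σ j - z))) :
    IsBlaschkeProduct (n + k) f := by
  -- Inverting the Cayley transform `N / D` gives `g = (N - D) / (N + D)`.
  set D := Lagrange.nodal Finset.univ σ
  set N := herglotzNumerator σ c κ
  have hone : (1 : ℂ) ∈ sphere (0 : ℂ) 1 := by simp
  have hdeg : (N - D).natDegree = n := by
    refine natDegree_herglotzNumerator_sub fun h ↦ ?_
    have := congrArg Complex.re h
    simp only [Complex.sub_re, hκ, Complex.re_sum, Complex.ofReal_re, Complex.one_re] at this
    have := Finset.sum_nonneg fun j (_ : j ∈ Finset.univ) ↦ (hc j).le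
    linarith
  have hsphere_off : ∀ z ∈ sphere (0 : ℂ) 1, (∀ j, σ j - z ≠ 0) →
      ‖(N - D).eval z‖ = ‖(N + D).eval z‖ ∧ (N + D).eval z ≠ 0 := by
    intro z hz hne
    have hz1 : ‖z‖ = 1 := by simpa using hz
    have hre := re_sum_herglotz (c := c) hσ hκ z
    rw [hz1] at hre
    simp only [one_pow, sub_self, zero_div, mul_zero, Finset.sum_const_zero] at hre
    rw [Polynomial.eval_sub, Polynomial.eval_add, eval_herglotzNumerator hne]
    set w := κ + ∑ j, c j * ((σ j + z) / (σ j - z))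
    rw [show w * D.eval z - D.eval z = (w - 1) * D.eval z by ring,
      show w * D.eval z + D.eval z = (w + 1) * D.eval z by ring, norm_mul, norm_mul,
      norm_sub_one_eq_norm_add_one hre]
    refine ⟨rfl, mul_ne_zero (fun h ↦ ?_) (eval_nodal_univ_ne_zero hne)⟩
    have := congrArg Complex.re h
    simp [hre] at this
  have hnode : ∀ i, D.eval (σ i) = 0 ∧ N.eval (σ i) ≠ 0 := by
    intro i
    refine ⟨Lagrange.eval_nodal_at_node (Finset.mem_univ i), ?_⟩
    rw [eval_herglotzNumerator_node]
    have h1 : σ i ≠ 0 := by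
      have := hσ i
      rintro h
      simp [h] at this
    have h2 : (Lagrange.nodal (Finset.univ.erase i) σ).eval (σ i) ≠ 0 :=
      Lagrange.eval_nodal_not_at_node fun j hj h ↦
        Finset.ne_of_mem_erase hj (hinj h.symm)
    have h3 : (c i : ℂ) ≠ 0 := by exact_mod_cast (hc i).ne'
    exact neg_ne_zero.2 (mul_ne_zero (mul_ne_zero (mul_ne_zero two_ne_zero h3) h1) h2)
  have hsphere : ∀ z ∈ sphere (0 : ℂ) 1,
      ‖(N - D).eval z‖ = ‖(N + D).eval z‖ ∧ (N + D).eval z ≠ 0 := by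
    intro z hz
    by_cases hne : ∀ j, σ j - z ≠ 0
    · exact hsphere_off z hz hne
    -- At a node `D` vanishes and `N` does not, so both values equal `N`.
    · push Not at hne
      obtain ⟨i, hi⟩ := hne
      rw [← sub_eq_zero.1 hi, Polynomial.eval_sub, Polynomial.eval_add, (hnode i).1]
      simpa using (hnode i).2
  have hball : ∀ z ∈ ball (0 : ℂ) 1, (N + D).eval z ≠ 0 ∧
      (N - D).eval z = g z * (N + D).eval z := by
    intro z hz
    have hne : ∀ j, σ j - z ≠ 0 := fun j ↦ sub_ne_zero_of_mem (hσ j) hz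
    have h1 := sub_ne_zero_of_mem hone (hg.2 hz)
    have hD : D.eval z ≠ 0 := eval_nodal_univ_ne_zero hne
    rw [Polynomial.eval_sub, Polynomial.eval_add, eval_herglotzNumerator hne, ← hh z hz]
    have h2 : (1 + g z) / (1 - g z) * D.eval z + D.eval z = 2 * D.eval z / (1 - g z) := by
      field_simp
      ring
    rw [h2]
    refine ⟨div_ne_zero (mul_ne_zero two_ne_zero hD) h1, ?_⟩
    field_simp
    ring
  have hND : N - D ≠ 0 := by
    intro h
    have := (hsphere 1 hone).1
    rw [h, Polynomial.eval_zero, norm_zero] at this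
    exact (hsphere 1 hone).2 (norm_eq_zero.1 this.symm)
  have houter : ∀ z, (N - D).eval z = 0 → z ∈ ball (0 : ℂ) 1 := by
    intro z hz0
    rw [mem_ball_zero_iff]
    by_contra! hz
    rcases hz.eq_or_lt with hz | hz
    · have hzs : z ∈ sphere (0 : ℂ) 1 := by simp [hz]
      have := (hsphere z hzs).1
      rw [hz0, norm_zero] at this
      exact (hsphere z hzs).2 (norm_eq_zero.1 this.symm)
    -- Outside the closed disk a zero of `N - D` would give `N / D = 1`, while the real part of `N /
    -- D` is at most 0 there.
    · have hne : ∀ j, σ j - z ≠ 0 := by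
        intro j h
        have : ‖σ j‖ = 1 := by simpa using hσ j
        rw [sub_eq_zero.1 h] at this
        linarith
      have hre := re_sum_herglotz (c := c) hσ hκ z
      rw [Polynomial.eval_sub, eval_herglotzNumerator hne, ← sub_one_mul, mul_eq_zero,
        or_iff_left (eval_nodal_univ_ne_zero hne), sub_eq_zero] at hz0
      rw [hz0, Complex.one_re] at hre
      have : ∑ j, c j * ((1 - ‖z‖ ^ 2) / ‖σ j - z‖ ^ 2) ≤ 0 :=
        Finset.sum_nonpos fun j _ ↦ mul_nonpos_of_nonneg_of_nonpos (hc j).le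
          (div_nonpos_of_nonpos_of_nonneg (by nlinarith) (by positivity))
      linarith
  have := isBlaschkeProduct_of_rational (f := f) (p := (N - D) * Polynomial.X ^ k) (q := N + D)
    (mul_ne_zero hND (pow_ne_zero _ Polynomial.X_ne_zero)) ?_ ?_ ?_ ?_
  · rwa [Polynomial.natDegree_mul_X_pow k hND, hdeg] at this
  · intro z hz
    simp only [Polynomial.eval_mul, Polynomial.eval_pow, Polynomial.eval_X, mul_eq_zero] at hz
    rcases hz with hz | hz
    · exact houter z hz
    · simp [eq_zero_of_pow_eq_zero hz]
  · intro z hz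
    rw [mem_closedBall_zero_iff] at hz
    rcases hz.eq_or_lt with hz | hz
    · exact (hsphere z (by simp [hz])).2
    · exact (hball z (by simpa using hz)).1
  · intro z hz
    have hz1 : ‖z‖ = 1 := by simpa using hz
    simp only [Polynomial.eval_mul, Polynomial.eval_pow, Polynomial.eval_X, norm_mul, norm_pow,
      hz1, one_pow, mul_one]
    exact (hsphere z hz).1
  · intro z hz
    obtain ⟨h1, h2⟩ := hball z hz
    rw [hfg, eq_div_iff h1, Polynomial.eval_mul, h2]
    simp only [Polynomial.eval_pow, Polynomial.eval_X]
    ring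

end

/-! ### Factorization of finite Blaschke products -/

open ComplexConjugate in
lemma one_sub_conj_mul_ne_zero {a z : ℂ} (ha : a ∈ ball (0 : ℂ) 1) (hz : z ∈ closedBall (0 : ℂ) 1) :
    1 - conj a * z ≠ 0 := by
  intro h
  have h2 := congrArg norm (sub_eq_zero.1 h)
  simp only [mem_ball_zero_iff, mem_closedBall_zero_iff] at ha hz
  simp only [norm_mul, RCLike.norm_conj, norm_one] at h2
  nlinarith [norm_nonneg a, norm_nonneg z]

open ComplexConjugate in
lemma norm_one_sub_conj_mul {z : ℂ} (a : ℂ) (hz : z ∈ sphere (0 : ℂ) 1) :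
    ‖1 - conj a * z‖ = ‖z - a‖ := by
  have hz1 : ‖z‖ = 1 := by simpa using hz
  rw [← sq_eq_sq₀ (norm_nonneg _) (norm_nonneg _), one_sub_conj_mul_normSq, hz1]
  ring

/-- The maximum principle for both `F` and `F⁻¹` forces `‖F 0‖ = 1`, an interior maximum. -/
lemma eq_const_of_unimodular_of_ne_zero {F : ℂ → ℂ} (hF : DiffContOnCl ℂ F (ball 0 1))
    (hs : ∀ z ∈ sphere (0 : ℂ) 1, ‖F z‖ = 1) (hne : ∀ z ∈ ball (0 : ℂ) 1, F z ≠ 0) :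
    ‖F 0‖ = 1 ∧ ∀ z ∈ ball (0 : ℂ) 1, F z = F 0 := by
  have hfr : frontier (ball (0 : ℂ) 1) = sphere 0 1 := frontier_ball 0 one_ne_zero
  have hcl : closure (ball (0 : ℂ) 1) = closedBall 0 1 := closure_ball 0 one_ne_zero
  have hne' : ∀ z ∈ closure (ball (0 : ℂ) 1), F z ≠ 0 := by
    intro z hz
    rw [hcl, mem_closedBall_zero_iff] at hz
    rcases hz.eq_or_lt with hz | hz
    · exact norm_ne_zero_iff.1 (by rw [hs z (by simp [hz])]; exact one_ne_zero)
    · exact hne z (by simpa using hz)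
  have h1 : ∀ z ∈ ball (0 : ℂ) 1, ‖F z‖ ≤ 1 := fun z hz ↦
    Complex.norm_le_of_forall_mem_frontier_norm_le isBounded_ball hF
      (fun w hw ↦ (hs w (hfr ▸ hw)).le) (subset_closure hz)
  have h2 : ∀ z ∈ ball (0 : ℂ) 1, ‖F⁻¹ z‖ ≤ 1 := fun z hz ↦
    Complex.norm_le_of_forall_mem_frontier_norm_le isBounded_ball (hF.inv hne')
      (fun w hw ↦ by simp [hs w (hfr ▸ hw)]) (subset_closure hz)
  have h0 : (0 : ℂ) ∈ ball (0 : ℂ) 1 := mem_ball_self one_pos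
  have h3 : ‖F 0‖ = 1 := by
    refine le_antisymm (h1 0 h0) ?_
    have := h2 0 h0
    rw [Pi.inv_apply, norm_inv] at this
    exact (inv_le_one₀ (norm_pos_iff.2 (hne 0 h0))).1 this
  refine ⟨h3, fun z hz ↦ ?_⟩
  exact Complex.eq_const_of_exists_max hF.1 h0 (fun w hw ↦ by simpa [h3] using h1 w hw) hz

open ComplexConjugate in
/-- Factorization of a finite Blaschke product. -/
lemma exists_blaschke_factorization (s : Multiset ℂ) (hs : ∀ a ∈ s, a ∈ ball (0 : ℂ) 1)
    {F : ℂ → ℂ} (hF : DiffContOnCl ℂ F (ball 0 1)) (hn : ∀ z ∈ sphere (0 : ℂ) 1, ‖F z‖ = 1)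
    (ho : ∀ z ∈ ball (0 : ℂ) 1, analyticOrderAt F z = (s.count z : ℕ∞)) :
    ∃ c : ℂ, ‖c‖ = 1 ∧ ∀ z ∈ ball (0 : ℂ) 1,
      F z * (s.map fun a ↦ 1 - conj a * z).prod = c * (s.map fun a ↦ z - a).prod := by
  induction s using Multiset.induction_on generalizing F with
  | empty =>
    have hne : ∀ z ∈ ball (0 : ℂ) 1, F z ≠ 0 := by
      intro z hz
      have hFz := hF.1.analyticAt (isOpen_ball.mem_nhds hz)
      exact hFz.analyticOrderAt_eq_zero.1 (by simpa using ho z hz)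
    obtain ⟨h1, h2⟩ := eq_const_of_unimodular_of_ne_zero hF hn hne
    exact ⟨F 0, h1, fun z hz ↦ by simpa using h2 z hz⟩
  | cons a s ih =>
    have ha : a ∈ ball (0 : ℂ) 1 := hs a (by simp)
    have hna : ball (0 : ℂ) 1 ∈ 𝓝 a := isOpen_ball.mem_nhds ha
    have hFa : F a = 0 := by
      refine apply_eq_zero_of_analyticOrderAt_ne_zero ?_
      rw [ho a ha]
      simp
    set G : ℂ → ℂ := fun z ↦ dslope F a z * (1 - conj a * z) with hG
    have hFG : ∀ z, F z * (1 - conj a * z) = (z - a) * G z := by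
      intro z
      have := sub_smul_dslope F a z
      rw [hFa, sub_zero, smul_eq_mul] at this
      rw [← this, hG]
      ring
    have hGd : DiffContOnCl ℂ G (ball 0 1) := by
      refine ⟨((Complex.differentiableOn_dslope hna).2 hF.1).mul (by fun_prop), ?_⟩
      refine ContinuousOn.mul ?_ (by fun_prop)
      exact (continuousOn_dslope (mem_of_superset hna subset_closure)).2
        ⟨hF.2, hF.1.differentiableAt hna⟩
    have hGn : ∀ z ∈ sphere (0 : ℂ) 1, ‖G z‖ = 1 := by
      intro z hz
      have h1 := congrArg norm (hFG z)
      rw [norm_mul, norm_mul, hn z hz, norm_one_sub_conj_mul a hz, one_mul] at h1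
      have h2 : 0 < ‖z - a‖ := by
        rw [norm_sub_rev]
        exact norm_sub_pos_of_mem hz ha |>.trans_eq (norm_sub_rev _ _)
      exact (mul_right_eq_self₀.1 h1.symm).resolve_right h2.ne'
    have hGo : ∀ z ∈ ball (0 : ℂ) 1, analyticOrderAt G z = (s.count z : ℕ∞) := by
      intro z hz
      have hFz := hF.1.analyticAt (isOpen_ball.mem_nhds hz)
      have hGz := hGd.1.analyticAt (isOpen_ball.mem_nhds hz)
      have hu : AnalyticAt ℂ (fun z ↦ 1 - conj a * z) z := by fun_prop
      have hv : AnalyticAt ℂ (fun z ↦ z - a) z := by fun_prop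
      have h1 : analyticOrderAt (F * fun z ↦ 1 - conj a * z) z =
          analyticOrderAt ((fun z ↦ z - a) * G) z := by
        congr 1
        exact funext hFG
      rw [analyticOrderAt_mul hFz hu, analyticOrderAt_mul hv hGz, ho z hz,
        hu.analyticOrderAt_eq_zero.2 (one_sub_conj_mul_ne_zero ha (ball_subset_closedBall hz)),
        add_zero, Multiset.count_cons] at h1
      by_cases hza : z = a
      · subst hza
        rw [analyticOrderAt_id_sub_const_self, if_pos rfl, Nat.cast_add, Nat.cast_one,
          add_comm] at h1
        exact (ENat.add_right_injective_of_ne_top ENat.one_ne_top h1).symm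
      · rw [analyticOrderAt_id_sub_const_of_ne hza, if_neg hza, add_zero, zero_add] at h1
        exact h1.symm
    obtain ⟨c, hc, h⟩ := ih (fun b hb ↦ hs b (by simp [hb])) hGd hGn hGo
    refine ⟨c, hc, fun z hz ↦ ?_⟩
    rw [Multiset.map_cons, Multiset.map_cons, Multiset.prod_cons, Multiset.prod_cons, ← mul_assoc,
      hFG, mul_assoc, h z hz]
    ring

open ComplexConjugate in
/-- If `z ^ k * g` is a Blaschke product of degree `n + k`, then `g` is an explicit quotient of
polynomials of degree at most `n`. -/
lemma IsBlaschkeProduct.exists_quotient {f g : ℂ → ℂ} {n k : ℕ} (hB : IsBlaschkeProduct (n + k) f)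
    (hg : DifferentiableOn ℂ g (ball 0 1)) (hfg : ∀ z, f z = z ^ k * g z) :
    ∃ p q : Polynomial ℂ, p.natDegree ≤ n ∧ q.natDegree ≤ n ∧
      (∀ z ∈ closedBall (0 : ℂ) 1, q.eval z ≠ 0) ∧
      (∀ z ∈ sphere (0 : ℂ) 1, ‖p.eval z‖ = ‖q.eval z‖) ∧
      ∀ z ∈ ball (0 : ℂ) 1, g z * q.eval z = p.eval z := by
  obtain ⟨hd, ⟨F, hFc, hFf, hFs⟩, s, hcard, hs, ho⟩ := hB
  have hcl : closure (ball (0 : ℂ) 1) = closedBall 0 1 := closure_ball 0 one_ne_zero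
  have h0 : (0 : ℂ) ∈ ball (0 : ℂ) 1 := mem_ball_self one_pos
  obtain ⟨c, hc, hfac⟩ := exists_blaschke_factorization s hs (F := F)
    ⟨hd.congr hFf, hcl ▸ hFc⟩ (fun z hz ↦ by simpa using hFs hz) (fun z hz ↦ by
      rw [← ho z hz]
      exact analyticOrderAt_congr (hFf.eventuallyEq_of_mem (isOpen_ball.mem_nhds hz)))
  -- At least `k` of the `n + k` zeros lie at 0; removing them leaves `n` zeros for `g`.
  have hk : k ≤ s.count 0 := by
    have h1 : (k : ℕ∞) ≤ analyticOrderAt f 0 := by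
      refine (natCast_le_analyticOrderAt (hd.analyticAt (isOpen_ball.mem_nhds h0))).2
        ⟨g, hg.analyticAt (isOpen_ball.mem_nhds h0), Eventually.of_forall fun z ↦ ?_⟩
      simp [hfg z]
    rw [ho 0 h0] at h1
    exact_mod_cast h1
  obtain ⟨s', rfl⟩ := Multiset.le_iff_exists_add.1 (Multiset.le_count_iff_replicate_le.1 hk)
  have hcard' : s'.card = n := by
    rw [Multiset.card_add, Multiset.card_replicate] at hcard
    omega
  have hs' : ∀ a ∈ s', a ∈ ball (0 : ℂ) 1 := fun a ha ↦ hs a (Multiset.mem_add.2 (Or.inr ha))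
  set p : Polynomial ℂ := Polynomial.C c * (s'.map fun a ↦ Polynomial.X - Polynomial.C a).prod
  set q : Polynomial ℂ := (s'.map fun a ↦ 1 - Polynomial.C (conj a) * Polynomial.X).prod
  have hp : ∀ z, p.eval z = c * (s'.map fun a ↦ z - a).prod := by
    intro z
    simp [p, Polynomial.eval_multiset_prod, Multiset.map_map]
  have hq : ∀ z, q.eval z = (s'.map fun a ↦ 1 - conj a * z).prod := by
    intro z
    simp [q, Polynomial.eval_multiset_prod, Multiset.map_map]
  have hgpq : ∀ z ∈ ball (0 : ℂ) 1, z ≠ 0 → g z * q.eval z = p.eval z := by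
    intro z hz hz0
    have := hfac z hz
    simp only [Multiset.map_add, Multiset.prod_add, Multiset.map_replicate, map_zero, zero_mul,
      sub_zero, Multiset.prod_replicate, one_pow, one_mul, hFf hz, hfg z, ← hq] at this
    refine mul_left_cancel₀ (pow_ne_zero k hz0) ?_
    rw [hp]
    linear_combination this
  refine ⟨p, q, ?_, ?_, ?_, ?_, ?_⟩
  · refine (Polynomial.natDegree_C_mul_le _ _).trans ?_
    rw [Polynomial.natDegree_multiset_prod_X_sub_C_eq_card, hcard']
  · refine (Polynomial.natDegree_multiset_prod_le _).trans ?_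
    rw [Multiset.map_map]
    refine (Multiset.sum_le_card_nsmul _ 1 ?_).trans ?_
    · intro m hm
      obtain ⟨a, -, rfl⟩ := Multiset.mem_map.1 hm
      simp only [Function.comp_apply]
      compute_degree
    · simp [hcard']
  · intro z hz
    rw [hq]
    refine Multiset.prod_ne_zero fun h ↦ ?_
    obtain ⟨a, ha, ha0⟩ := Multiset.mem_map.1 h
    exact one_sub_conj_mul_ne_zero (hs' a ha) hz ha0
  · intro z hz
    rw [hp, hq, norm_mul, hc, one_mul]
    change (normHom : ℂ →*₀ ℝ) _ = (normHom : ℂ →*₀ ℝ) _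
    rw [map_multiset_prod, map_multiset_prod]
    simp only [Multiset.map_map, Function.comp_def]
    congr 1
    exact Multiset.map_congr rfl fun a _ ↦ (norm_one_sub_conj_mul a hz).symm
  · intro z hz
    by_cases hz0 : z = 0
    · subst hz0
      have h1 : ContinuousAt (fun z ↦ g z * q.eval z) 0 :=
        (hg.continuousOn.continuousAt (isOpen_ball.mem_nhds h0)).mul q.continuous.continuousAt
      refine tendsto_nhds_unique (h1.tendsto.mono_left (nhdsWithin_le_nhds (s := {0}ᶜ)))
        ((p.continuous.tendsto 0 |>.mono_left nhdsWithin_le_nhds).congr' ?_)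
      filter_upwards [self_mem_nhdsWithin, nhdsWithin_le_nhds (isOpen_ball.mem_nhds h0)]
        with w hw hw' using (hgpq w hw' hw).symm
    · exact hgpq z hz hz0

/-! ### For a Blaschke product the point masses exhaust the total mass -/

/-- The difference of the two sides has degree below `n` and vanishes at `n` distinct points. -/
lemma eq_C_mul_nodal {n : ℕ} {σ : Fin n → ℂ} (hinj : Function.Injective σ) {P : Polynomial ℂ}
    (hdeg : P.natDegree ≤ n) (h : ∀ j, P.eval (σ j) = 0) :
    P = Polynomial.C (P.coeff n) * Lagrange.nodal Finset.univ σ := by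
  have hD : (Lagrange.nodal Finset.univ σ).natDegree = n := by
    rw [Lagrange.natDegree_nodal, Finset.card_univ, Fintype.card_fin]
  have hD1 : (Lagrange.nodal Finset.univ σ).coeff n = 1 := by
    have := (Lagrange.nodal_monic (s := Finset.univ) (v := σ)).coeff_natDegree
    rwa [hD] at this
  rw [← sub_eq_zero]
  refine Polynomial.eq_zero_of_degree_lt_of_eval_index_eq_zero (s := Finset.univ) (v := σ) hinj.injOn ?_ ?_
  · rw [Finset.card_univ, Fintype.card_fin, Polynomial.degree_lt_iff_coeff_zero]
    intro m hm
    rw [Polynomial.coeff_sub, Polynomial.coeff_C_mul]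
    rcases hm.eq_or_lt with rfl | hm
    · rw [hD1, mul_one, sub_self]
    · rw [Polynomial.coeff_eq_zero_of_natDegree_lt (hdeg.trans_lt hm),
        Polynomial.coeff_eq_zero_of_natDegree_lt (hD.le.trans_lt hm), mul_zero, sub_self]
  · intro j _
    rw [Polynomial.eval_sub, h j, Polynomial.eval_mul,
      Lagrange.eval_nodal_at_node (Finset.mem_univ j), mul_zero, sub_self]

lemma natDegree_herglotzNumerator_le {n : ℕ} {σ : Fin n → ℂ} {c : Fin n → ℝ} {κ : ℂ} :
    (herglotzNumerator σ c κ).natDegree ≤ n := by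
  refine (Polynomial.natDegree_sub_le _ _).trans (max_le ?_ ?_)
  · refine (Polynomial.natDegree_C_mul_le _ _).trans ?_
    rw [Lagrange.natDegree_nodal, Finset.card_univ, Fintype.card_fin]
  · exact Polynomial.natDegree_le_of_degree_le (degree_sum_nodal_erase_lt _).le

lemma tendsto_eval_radial (P : Polynomial ℂ) (σ : ℂ) :
    Tendsto (fun r : ℝ ↦ P.eval (r * σ)) (𝓝[<] 1) (𝓝 (P.eval σ)) := by
  have hc : Continuous (fun r : ℝ ↦ P.eval (r * σ)) := P.continuous.comp (by fun_prop)
  simpa using (hc.tendsto 1).mono_left (nhdsWithin_le_nhds (s := Set.Iio 1))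

lemma exists_mem_sphere_forall_sub_ne_zero {n : ℕ} (σ : Fin n → ℂ) :
    ∃ ζ ∈ sphere (0 : ℂ) 1, ∀ j, σ j - ζ ≠ 0 := by
  have hinf : (sphere (0 : ℂ) 1).Infinite := by
    refine (isPreconnected_sphere (by simp) 0 1).infinite_of_nontrivial ?_
    exact ⟨1, by simp, -1, by simp, by norm_num⟩
  obtain ⟨ζ, hζ, hne⟩ := hinf.exists_notMem_finite (Set.finite_range σ)
  exact ⟨ζ, hζ, fun j h ↦ hne ⟨j, sub_eq_zero.1 h⟩⟩

/-- If `g` is a quotient of polynomials of degree at most `n` with unimodular boundary values, then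
`n` point masses of its Cayley transform exhaust the total mass. -/
lemma re_cayley_zero_eq_sum {g : ℂ → ℂ} (hg : IsDiskSelfMap g) {n : ℕ} {p q : Polynomial ℂ}
    (hp : p.natDegree ≤ n) (hq : q.natDegree ≤ n) (hq0 : ∀ z ∈ closedBall (0 : ℂ) 1, q.eval z ≠ 0)
    (hnorm : ∀ z ∈ sphere (0 : ℂ) 1, ‖p.eval z‖ = ‖q.eval z‖)
    (hgpq : ∀ z ∈ ball (0 : ℂ) 1, g z * q.eval z = p.eval z) {σ : Fin n → ℂ}
    (hσ : ∀ j, σ j ∈ sphere (0 : ℂ) 1) (hinj : Function.Injective σ) {c : Fin n → ℝ}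
    (hc : ∀ j, 0 < c j)
    (hlim : ∀ j, Tendsto (fun r : ℝ ↦
      ((1 - r) / (1 + r) : ℂ) * ((1 + g (r * σ j)) / (1 - g (r * σ j)))) (𝓝[<] 1)
      (𝓝 (c j : ℂ))) :
    ((1 + g 0) / (1 - g 0)).re = ∑ j, c j := by
  have hone : (1 : ℂ) ∈ sphere (0 : ℂ) 1 := by simp
  have h0 : (0 : ℂ) ∈ ball (0 : ℂ) 1 := mem_ball_self one_pos
  have h1g : ∀ z ∈ ball (0 : ℂ) 1, 1 - g z ≠ 0 := fun z hz ↦ sub_ne_zero_of_mem hone (hg.2 hz)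
  set D := Lagrange.nodal Finset.univ σ with hD
  have hQ : ∀ z ∈ ball (0 : ℂ) 1, (q - p).eval z = q.eval z * (1 - g z) := by
    intro z hz
    rw [Polynomial.eval_sub, ← hgpq z hz]
    ring
  have hR : ∀ z ∈ ball (0 : ℂ) 1, (q + p).eval z = q.eval z * (1 + g z) := by
    intro z hz
    rw [Polynomial.eval_add, ← hgpq z hz]
    ring
  have hg1 : ∀ j, Tendsto (fun r : ℝ ↦ g (r * σ j)) (𝓝[<] 1) (𝓝 1) := by
    intro j
    refine tendsto_of_tendsto_sub_div (tendsto_sub_div_of_tendsto_cayley one_ne_zero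
      (by exact_mod_cast (hc j).ne') ?_ (hlim j))
    filter_upwards [eventually_mem_Ioo_zero_one] with r hr
    exact h1g _ (ofReal_mul_mem_ball (hσ j) hr.1 hr.2)
  -- A positive mass forces `g → 1` radially. The degree bound then makes `q - p` a multiple of `D`,
  -- so the Cayley transform has no poles other than the `σ j`.
  have hQσ : ∀ j, (q - p).eval (σ j) = 0 := by
    intro j
    have h1 := (tendsto_eval_radial q (σ j)).mul ((hg1 j).const_sub 1)
    rw [sub_self, mul_zero] at h1
    refine tendsto_nhds_unique (tendsto_eval_radial (q - p) (σ j)) (h1.congr' ?_)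
    filter_upwards [eventually_mem_Ioo_zero_one] with r hr
    exact (hQ _ (ofReal_mul_mem_ball (hσ j) hr.1 hr.2)).symm
  have hQD := eq_C_mul_nodal hinj ((Polynomial.natDegree_sub_le _ _).trans (max_le hq hp)) hQσ
  rw [← hD] at hQD
  set d := (q - p).coeff n
  have hQe : ∀ z, (q - p).eval z = d * D.eval z := by
    intro z
    conv_lhs => rw [hQD]
    simp
  have hd : d ≠ 0 := by
    intro h
    have h1 := hQe 0
    rw [h, zero_mul, hQ 0 h0] at h1
    exact mul_ne_zero (hq0 0 (by simp)) (h1g 0 h0) h1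
  -- `T / (d * D)` is the Cayley transform minus its point masses, that is, `K`.
  set T := q + p - Polynomial.C d * herglotzNumerator σ c 0 with hT
  have hTdeg : T.natDegree ≤ n := by
    refine (Polynomial.natDegree_sub_le _ _).trans (max_le ?_ ?_)
    · exact (Polynomial.natDegree_add_le _ _).trans (max_le hq hp)
    · exact (Polynomial.natDegree_C_mul_le _ _).trans natDegree_herglotzNumerator_le
  set K : ℂ → ℂ := fun z ↦ (1 + g z) / (1 - g z) - ∑ j, c j * ((σ j + z) / (σ j - z)) with hK
  have hTK : ∀ z ∈ ball (0 : ℂ) 1, T.eval z = d * D.eval z * K z := by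
    intro z hz
    have hne : ∀ j, σ j - z ≠ 0 := fun j ↦ sub_ne_zero_of_mem (hσ j) hz
    have h1 : (q + p).eval z = (1 + g z) / (1 - g z) * (d * D.eval z) := by
      rw [← hQe z, hQ z hz, hR z hz]
      have := h1g z hz
      field_simp
    rw [hT, Polynomial.eval_sub, h1, Polynomial.eval_mul, Polynomial.eval_C,
      eval_herglotzNumerator hne, zero_add]
    ring
  have hTσ : ∀ i, T.eval (σ i) = 0 := by
    intro i
    have h1 := tendsto_sub_sum_herglotz (H := fun z ↦ (1 + g z) / (1 - g z)) hσ hinj (hlim i)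
      Finset.univ
    rw [if_pos (Finset.mem_univ i)] at h1
    -- The factor `r σ - σ = -(1 - r) σ` of `D` supplies the normalization of `K`, up to `1 + r`. As
    -- `K` has no mass left at `σ i`, `T` vanishes there, and `K` is the constant `t / d`.
    have h2 : Tendsto (fun r : ℝ ↦ -(d * ((1 + r : ℂ) * σ i *
        (Lagrange.nodal (Finset.univ.erase i) σ).eval (r * σ i)))) (𝓝[<] 1)
        (𝓝 (-(d * ((1 + (1 : ℝ) : ℂ) * σ i *
          (Lagrange.nodal (Finset.univ.erase i) σ).eval (σ i))))) := by
      refine Tendsto.neg (Tendsto.const_mul d (Tendsto.mul ?_ (tendsto_eval_radial _ _)))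
      have hc : Continuous (fun r : ℝ ↦ (1 + r : ℂ) * σ i) := by fun_prop
      exact (hc.tendsto 1).mono_left nhdsWithin_le_nhds
    have h3 := h2.mul h1
    rw [mul_zero] at h3
    refine tendsto_nhds_unique (tendsto_eval_radial T (σ i)) (h3.congr' ?_)
    filter_upwards [eventually_mem_Ioo_zero_one] with r hr
    have h6 : (1 + r : ℂ) ≠ 0 := by exact_mod_cast (by linarith : (1 + r : ℝ) ≠ 0)
    rw [hTK _ (ofReal_mul_mem_ball (hσ i) hr.1 hr.2), hD, eval_nodal_univ_eq _ i]
    simp only [hK]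
    field_simp
    ring
  have hTD := eq_C_mul_nodal hinj hTdeg hTσ
  rw [← hD] at hTD
  set t := T.coeff n
  have hTe : ∀ z, T.eval z = t * D.eval z := by
    intro z
    conv_lhs => rw [hTD]
    simp
  have hK0 : K 0 = t / d := by
    have hD0 : D.eval 0 ≠ 0 :=
      eval_nodal_univ_ne_zero fun j ↦ sub_ne_zero_of_mem (hσ j) h0
    have h1 := hTK 0 h0
    rw [hTe 0] at h1
    rw [eq_div_iff hd]
    refine mul_right_cancel₀ hD0 ?_
    linear_combination -h1
  -- At a point of the circle off the nodes, the Cayley transform of `p / q` and all the kernels are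
  -- purely imaginary.
  have hre : (t / d).re = 0 := by
    obtain ⟨ζ, hζ, hne⟩ := exists_mem_sphere_forall_sub_ne_zero σ
    have hDζ : D.eval ζ ≠ 0 := eval_nodal_univ_ne_zero hne
    have hζ1 : ‖ζ‖ = 1 := by simpa using hζ
    have h1 : (q.eval ζ + p.eval ζ) / (q.eval ζ - p.eval ζ) =
        t / d + (0 + ∑ j, c j * ((σ j + ζ) / (σ j - ζ))) := by
      have h2 := hTe ζ
      rw [hT, Polynomial.eval_sub, Polynomial.eval_add, Polynomial.eval_mul, Polynomial.eval_C,
        eval_herglotzNumerator hne] at h2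
      have h3 := hQe ζ
      rw [Polynomial.eval_sub] at h3
      rw [h3, div_eq_iff (mul_ne_zero hd hDζ), add_mul, ← mul_assoc (t / d), div_mul_cancel₀ _ hd]
      linear_combination h2
    have h4 := re_sum_herglotz (c := c) hσ Complex.zero_re ζ
    have h5 := congrArg Complex.re h1
    rw [re_add_div_sub, hnorm ζ hζ, sub_self, zero_div, Complex.add_re, h4, hζ1] at h5
    simpa using h5.symm
  have h4 := re_sum_herglotz (c := c) hσ Complex.zero_re 0
  have h6 : (1 + g 0) / (1 - g 0) = K 0 + (0 + ∑ j, c j * ((σ j + 0) / (σ j - 0))) := by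
    simp only [hK]
    ring
  rw [h6, Complex.add_re, hK0, hre, h4, zero_add]
  refine Finset.sum_congr rfl fun j _ ↦ ?_
  rw [sub_zero, show ‖σ j‖ = 1 by simpa using hσ j]
  simp

/-! ### The main theorem -/

theorem corollary3p10 (f : ℂ → ℂ) (hf : IsDiskSelfMap f) (k : ℕ) (hk : 1 ≤ k)
    (hB : ∀ d : ℕ, d ≤ k → ¬ IsBlaschkeProduct d f)
    (h0 : ∀ i : ℕ, i < k → iteratedDeriv i f 0 = 0)
    (n : ℕ) (σ : Fin n → ℂ) (hσ : ∀ j, σ j ∈ sphere (0 : ℂ) 1) (hinj : Function.Injective σ)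
    (hlim : ∀ j, HasNonTangentialLimit f (σ j) (σ j ^ k))
    (hβ : ∀ j, boundaryDilation f (σ j) < ⊤) :
    (∀ j, (k : ℝ) < (boundaryDilation f (σ j)).toReal) ∧
    iteratedDeriv k f 0 / (k.factorial : ℂ) ≠ 1 ∧
    ∑ j, 1 / ((boundaryDilation f (σ j)).toReal - (k : ℝ)) ≤
      (1 - ‖iteratedDeriv k f 0 / (k.factorial : ℂ)‖ ^ 2) /
        ‖1 - iteratedDeriv k f 0 / (k.factorial : ℂ)‖ ^ 2 ∧
    (∑ j, 1 / ((boundaryDilation f (σ j)).toReal - (k : ℝ)) =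
      (1 - ‖iteratedDeriv k f 0 / (k.factorial : ℂ)‖ ^ 2) /
        ‖1 - iteratedDeriv k f 0 / (k.factorial : ℂ)‖ ^ 2 ↔
      IsBlaschkeProduct (n + k) f) := by
  obtain ⟨g, hgd, hfg, hg0, hgle⟩ := exists_eq_pow_mul hf hk h0
  have hg := isDiskSelfMap_quotient hgd hfg hgle (hB k le_rfl)
  have hone : (1 : ℂ) ∈ sphere (0 : ℂ) 1 := by simp
  have hz : (0 : ℂ) ∈ ball (0 : ℂ) 1 := mem_ball_self one_pos
  have hmass := fun j ↦ tendsto_cayley_quotient hf hg (fun z _ ↦ hfg z) (hσ j) (hβ j)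
    ((hlim j).tendsto_radial (hσ j))
  set c : Fin n → ℝ := fun j ↦ 1 / ((boundaryDilation f (σ j)).toReal - (k : ℝ))
  have hc : ∀ j, 0 < c j := fun j ↦ one_div_pos.2 (sub_pos.2 (hmass j).1)
  set H : ℂ → ℂ := fun z ↦ (1 + g z) / (1 - g z) with hH
  have hHd : DifferentiableOn ℂ H (ball 0 1) := differentiableOn_cayley hg hone
  have hHre : ∀ z ∈ ball (0 : ℂ) 1, 0 ≤ (H z).re := fun z hz ↦ (cayley_re_pos hg hone hz).le
  have hH0 : (H 0).re = (1 - ‖g 0‖ ^ 2) / ‖1 - g 0‖ ^ 2 := by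
    rw [hH, re_add_div_sub, norm_one, one_pow]
  have hKre := re_sub_sum_herglotz_nonneg hHd hHre hσ hinj (fun j ↦ (hmass j).2) Finset.univ
  have hKd := differentiableOn_sub_sum_herglotz hHd hσ c Finset.univ
  have hsum : (∑ j, c j * ((σ j + 0) / (σ j - 0)) : ℂ).re = ∑ j, c j := by
    rw [Complex.re_sum]
    refine Finset.sum_congr rfl fun j _ ↦ ?_
    have : σ j ≠ 0 := by simpa using sub_ne_zero_of_mem (hσ j) hz
    rw [add_zero, sub_zero, div_self this, mul_one, Complex.ofReal_re]
  rw [← hg0, ← hH0]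
  refine ⟨fun j ↦ (hmass j).1, fun h ↦ sub_ne_zero_of_mem hone (hg.2 hz) (by rw [h, sub_self]),
    ?_, fun heq ↦ ?_, fun hBl ↦ ?_⟩
  · have := hKre 0 hz
    rw [Complex.sub_re, hsum] at this
    linarith
  -- Equality makes the remainder imaginary at 0, hence constant; this constant is the `κ` of the
  -- Blaschke criterion.
  · have hK0 : (H 0 - ∑ j, c j * ((σ j + 0) / (σ j - 0))).re = 0 := by
      rw [Complex.sub_re, hsum, ← heq, sub_self]
    refine isBlaschkeProduct_of_cayley_eq hg hfg hσ hinj hc hK0 fun z hz ↦ ?_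
    rw [← eq_const_of_re_eq_zero hKd hKre hK0 hz, sub_add_cancel]
  · obtain ⟨p, q, hp, hq, hq0, hnorm, hgpq⟩ := hBl.exists_quotient hgd hfg
    exact (re_cayley_zero_eq_sum hg hp hq hq0 hnorm hgpq hσ hinj hc fun j ↦ (hmass j).2).symm
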